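/- Let $(M^{2n},\Omega)$ be a connected symplectic manifold without boundary (Hausdorff, second countable; closed or open), with canonical volume form $\mathrm{Vol}=\Omega^n/n!$. For a smooth function $u$ the field $\operatorname{sgrad}u$ is defined by $i_{\operatorname{sgrad}u}\Omega=-du$. Let $\mathcal A$ be the space of smooth functions on $M$ with zero mean with respect to $\mathrm{Vol}$ if $M$ is closed, and of smooth compactly supported functions if $M$ is open; put $\|u\|=\max u-\min u$. A smooth function $F(x,t)=F_t(x)$ on $M\times I$ ($I$ an interval) is a normalized Hamiltonian if $F_t\in\mathcal A$ for all $t\in I$ and, for open $M$, the supports of all $F_t$ lie in a common compact set. A path of diffeomorphisms $\{f_t\}_{t\in I}$ is a family of diffeomorphisms of $M$ which is smooth in $(x,t)$ and has supports in a common compact set; $F$ generates it (is its normalized Hamiltonian) if $\frac{d}{dt}f_t=\operatorname{sgrad}F_t\circ f_t$. The Hamiltonian flow of $F$ (for $0\in I$) is the path generated by $F$ with $f_0=\mathbb 1$. $\mathrm{Ham}(M,\Omega)$ is the set of time-one maps of Hamiltonian flows of normalized Hamiltonians on $M\times[0,1]$. A Hamiltonian path is a path of diffeomorphisms $\{f_t\}_{t\in[0,1]}$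 in $\mathrm{Ham}(M,\Omega)$; its length is $\int_0^1\|F_t\|\,dt$, where $F$ is its normalized Hamiltonian. Hofer's distance $\rho(\varphi,\psi)$ is the infimum of the lengths of Hamiltonian paths from $\varphi$ to $\psi$. Homotopies of paths $[0,1]\to\mathrm{Ham}(M,\Omega)$ are smooth families $k_{s,t}\in \mathrm{Ham}(M,\Omega)$, $s,t\in[0,1]$, with fixed endpoints and with supports in a common compact set. Let $\mathcal F$ be the space of normalized Hamiltonians $F:M\times\mathbb R\to\mathbb R$ with $F(x,t+1)=F(x,t)$, with the norm $|||F|||=\max_t\|F_t\|$. For $F\in\mathcal F$ with Hamiltonian flow $\{f_t\}$ put $\varphi_F=f_1$, and let $l(F)$ be the infimum of the lengths of Hamiltonian paths $\{g_t\}_{t\in[0,1]}$ with $g_0=\mathbb 1$, $g_1=\varphi_F$ which are homotopic to $\{f_t\}_{t\in[0,1]}$ with fixed endpoints. Let $\mathcal H=\{H\in\mathcal F:\varphi_H=\mathbb 1\}$, and let $\mathcal H_c\subset\mathcal H$ be the set of those $H$ whose loop $\{h_t\}_{t\in[0,1]}$ is contractible, that is, homotopic with fixed endpoints to the constant loop $\mathbb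 1$. Theorem. For every $F\in\mathcal F$, $$\rho(\mathbb 1,\varphi_F)=\inf_{H\in\mathcal H}|||F-H|||\qquad\text{and}\qquad l(F)=\inf_{H\in\mathcal H_c}|||F-H|||.$$ -/

import Mathlib

open Set MeasureTheory
open scoped Manifold ContDiff

noncomputable section

namespace Hofer

/-- The model space `ℝ^{2n}`. -/
abbrev Model (n : ℕ) : Type := EuclideanSpace ℝ (Fin (2 * n))

/-- The `L_∞`-norm `max u - min u`. -/
def osc {M : Type*} (u : M → ℝ) : ℝ := (⨆ x, u x) - ⨅ x, u x

/-- The norm `|||F||| = max_t ‖F_t‖` on time-dependent functions. -/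
def uniformNorm {M : Type*} (F : ℝ → M → ℝ) : ℝ := ⨆ t : ℝ, osc (F t)

section Forms

variable {n : ℕ} {M : Type*} [TopologicalSpace M] [ChartedSpace (Model n) M]

/-- The coordinate expression of a 2-form `η` on `M` in the chart around `x₀`: the pullback of `η`
under the inverse of the chart, a 2-form on the (open) target of the chart in `ℝ^{2n}`. -/
def chartForm (η : (x : M) → TangentSpace (𝓡 (2 * n)) x [⋀^Fin 2]→L[ℝ] ℝ) (x₀ : M) :
    Model n → Model n [⋀^Fin 2]→L[ℝ] ℝ :=
  fun y => (η ((extChartAt (𝓡 (2 * n)) x₀).symm y)).compContinuousLinearMap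
    (mfderiv 𝓘(ℝ, Model n) (𝓡 (2 * n)) (extChartAt (𝓡 (2 * n)) x₀).symm y)

variable (n M) in
/-- A symplectic form on the `2n`-dimensional manifold `M`: a smooth, closed, nondegenerate
differential 2-form (smoothness and closedness are expressed in charts). -/
structure SymplecticForm where
  form : (x : M) → TangentSpace (𝓡 (2 * n)) x [⋀^Fin 2]→L[ℝ] ℝ
  smooth : ∀ x₀ : M, ContDiffOn ℝ ∞ (chartForm form x₀) (extChartAt (𝓡 (2 * n)) x₀).target
  closed : ∀ x₀ : M, ∀ y ∈ (extChartAt (𝓡 (2 * n)) x₀).target,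
    extDeriv (chartForm form x₀) y = 0
  nondegenerate : ∀ (x : M) (u : TangentSpace (𝓡 (2 * n)) x), u ≠ 0 →
    ∃ v : TangentSpace (𝓡 (2 * n)) x, form x ![u, v] ≠ 0

/-- The Gram matrix `(Ω(∂ᵢ, ∂ⱼ))ᵢⱼ` of `Ω` in the chart around `x₀`, at the point with
coordinates `y`. -/
def gramMatrix (Ω : SymplecticForm n M) (x₀ : M) (y : Model n) :
    Matrix (Fin (2 * n)) (Fin (2 * n)) ℝ :=
  Matrix.of fun i j =>
    chartForm Ω.form x₀ y ![EuclideanSpace.single i (1 : ℝ), EuclideanSpace.single j (1 : ℝ)]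

/-- The measure of the volume form `Ω^n / n!` on the domain of the chart around `x₀` (extended by
zero to `M`). In coordinates `Ω^n / n!` is `± √(det (Ω(∂ᵢ, ∂ⱼ))) dy₁ ∧ … ∧ dy₂ₙ`, the square root
of the determinant being the absolute value of the Pfaffian. -/
def chartVolume [MeasurableSpace M] (Ω : SymplecticForm n M) (x₀ : M) : Measure M :=
  Measure.map (extChartAt (𝓡 (2 * n)) x₀).symm
    ((volume.restrict (extChartAt (𝓡 (2 * n)) x₀).target).withDensity
      fun y => ENNReal.ofReal √(gramMatrix Ω x₀ y).det)

/-- The measure on `M` of the canonical volume form `Vol = Ω^n / n!`: the supremum (gluing) of the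
measures on the chart domains, which agree on overlaps. -/
def symplecticVolume [MeasurableSpace M] (Ω : SymplecticForm n M) : Measure M :=
  ⨆ x₀ : M, chartVolume Ω x₀

end Forms

variable {n : ℕ} {M : Type*} [TopologicalSpace M] [ChartedSpace (Model n) M]

variable (n M) in
/-- Smooth diffeomorphisms of `M`. -/
abbrev Diff : Type _ := M ≃ₘ⟮𝓡 (2 * n), 𝓡 (2 * n)⟯ M

/-- The space `𝒜(M)`: smooth functions of zero mean with respect to the canonical volume if `M` is
closed, smooth functions with compact support if `M` is open (not compact). -/
def normalizedFunctions [MeasurableSpace M] (Ω : SymplecticForm n M) : Set (M → ℝ) :=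
  {u | ContMDiff (𝓡 (2 * n)) 𝓘(ℝ, ℝ) ∞ u ∧
    (CompactSpace M → ∫ x, u x ∂(symplecticVolume Ω) = 0) ∧
    (NoncompactSpace M → HasCompactSupport u)}

/-- `F = (F_t)` is a normalized (time-dependent) Hamiltonian on `M × J`. -/
structure IsNormalizedHamiltonian [MeasurableSpace M] (Ω : SymplecticForm n M) (J : Set ℝ)
    (F : ℝ → M → ℝ) : Prop where
  smooth : ContMDiffOn ((𝓡 (2 * n)).prod 𝓘(ℝ, ℝ)) 𝓘(ℝ, ℝ) ∞
    (fun p : M × ℝ => F p.2 p.1) (univ ×ˢ J)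
  normalized : ∀ t ∈ J, F t ∈ normalizedFunctions Ω
  support : NoncompactSpace M → ∃ K : Set M, IsCompact K ∧ ∀ t ∈ J, tsupport (F t) ⊆ K

/-- `{f_t}`, `t ∈ J`, is a path of diffeomorphisms: smooth in `(x, t)`, with the supports of all
`f_t` in a common compact set. -/
structure IsDiffPath (J : Set ℝ) (f : ℝ → Diff n M) : Prop where
  smooth : ContMDiffOn ((𝓡 (2 * n)).prod 𝓘(ℝ, ℝ)) (𝓡 (2 * n)) ∞
    (fun p : M × ℝ => f p.2 p.1) (univ ×ˢ J)
  support : ∃ K : Set M, IsCompact K ∧ ∀ t ∈ J, closure {x | f t x ≠ x} ⊆ K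

/-- `ξ ∈ T_x M` is the value at `x` of the Hamiltonian vector field `sgrad u`, which is defined by
`i_ξ Ω = -du`. -/
def IsSgradAt (Ω : SymplecticForm n M) (u : M → ℝ) (x : M)
    (ξ : TangentSpace (𝓡 (2 * n)) x) : Prop :=
  ∀ w : TangentSpace (𝓡 (2 * n)) x, Ω.form x ![ξ, w] = -(mfderiv (𝓡 (2 * n)) 𝓘(ℝ, ℝ) u x w)

/-- `d/dt f_t x = sgrad F_t (f_t x)` for all `x ∈ M` and `t ∈ J`. -/
def Generates (Ω : SymplecticForm n M) (J : Set ℝ) (F : ℝ → M → ℝ) (f : ℝ → Diff n M) : Prop :=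
  ∀ t ∈ J, ∀ x : M, ∃ ξ : TangentSpace (𝓡 (2 * n)) (f t x),
    IsSgradAt Ω (F t) (f t x) ξ ∧
    HasMFDerivWithinAt 𝓘(ℝ, ℝ) (𝓡 (2 * n)) (fun s => f s x) J t
      ((ContinuousLinearMap.id ℝ ℝ).smulRight ξ)

/-- `{f_t}`, `t ∈ J`, is the Hamiltonian flow generated by `F` (with `0 ∈ J`): the path of
diffeomorphisms with `f_0 = 𝟙` and `d/dt f_t = sgrad F_t ∘ f_t`. -/
structure IsHamiltonianFlow (Ω : SymplecticForm n M) (J : Set ℝ) (F : ℝ → M → ℝ)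
    (f : ℝ → Diff n M) : Prop where
  path : IsDiffPath J f
  zero : f 0 = Diffeomorph.refl (𝓡 (2 * n)) M ∞
  generates : Generates Ω J F f

variable [MeasurableSpace M]

/-- `Ham(M, Ω)`: the time-one maps of Hamiltonian flows of normalized Hamiltonians on
`M × [0, 1]`. -/
def Ham (Ω : SymplecticForm n M) : Set (Diff n M) :=
  {φ | ∃ (F : ℝ → M → ℝ) (f : ℝ → Diff n M), IsNormalizedHamiltonian Ω (Icc 0 1) F ∧
    IsHamiltonianFlow Ω (Icc 0 1) F f ∧ f 1 = φ}

/-- `{f_t}`, `t ∈ [0, 1]`, is a Hamiltonian path: a path of diffeomorphisms in `Ham(M, Ω)`. -/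
def IsHamiltonianPath (Ω : SymplecticForm n M) (f : ℝ → Diff n M) : Prop :=
  IsDiffPath (Icc 0 1) f ∧ ∀ t ∈ Icc (0 : ℝ) 1, f t ∈ Ham Ω

/-- `ℓ` is the Hofer length `∫₀¹ ‖F_t‖ dt` of the Hamiltonian path `{f_t}`, `t ∈ [0, 1]`, where `F`
is the normalized Hamiltonian of the path. -/
def HasLength (Ω : SymplecticForm n M) (f : ℝ → Diff n M) (ℓ : ℝ) : Prop :=
  ∃ F : ℝ → M → ℝ, IsNormalizedHamiltonian Ω (Icc 0 1) F ∧ Generates Ω (Icc 0 1) F f ∧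
    ℓ = ∫ t in (0 : ℝ)..1, osc (F t)

/-- The Hofer (pseudo)distance `ρ(φ, ψ)`: the infimum of the lengths of Hamiltonian paths from `φ`
to `ψ`. -/
def hoferDist (Ω : SymplecticForm n M) (φ ψ : Diff n M) : ℝ :=
  sInf {ℓ | ∃ f : ℝ → Diff n M, IsHamiltonianPath Ω f ∧ f 0 = φ ∧ f 1 = ψ ∧ HasLength Ω f ℓ}

/-- Two Hamiltonian paths `{f_t}`, `{g_t}`, `t ∈ [0, 1]`, are homotopic with fixed endpoints: there
is a smooth family `k_{s,t}`, `s, t ∈ [0, 1]`, in `Ham(M, Ω)` with supports in a common compact set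
and `k_{0,t} = f_t`, `k_{1,t} = g_t`, `k_{s,0} = f_0`, `k_{s,1} = f_1`. -/
def AreHomotopic (Ω : SymplecticForm n M) (f g : ℝ → Diff n M) : Prop :=
  ∃ k : ℝ → ℝ → Diff n M,
    ContMDiffOn ((𝓡 (2 * n)).prod (𝓘(ℝ, ℝ).prod 𝓘(ℝ, ℝ))) (𝓡 (2 * n)) ∞
      (fun p : M × ℝ × ℝ => k p.2.1 p.2.2 p.1) (univ ×ˢ Icc 0 1 ×ˢ Icc 0 1) ∧
    (∃ K : Set M, IsCompact K ∧
      ∀ s ∈ Icc (0 : ℝ) 1, ∀ t ∈ Icc (0 : ℝ) 1, closure {x | k s t x ≠ x} ⊆ K) ∧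
    (∀ s ∈ Icc (0 : ℝ) 1, ∀ t ∈ Icc (0 : ℝ) 1, k s t ∈ Ham Ω) ∧
    (∀ t ∈ Icc (0 : ℝ) 1, k 0 t = f t ∧ k 1 t = g t) ∧
    ∀ s ∈ Icc (0 : ℝ) 1, k s 0 = f 0 ∧ k s 1 = f 1

/-- For a path `{f_t}`, `t ∈ [0, 1]`, the infimum of the lengths of Hamiltonian paths with the same
endpoints which are homotopic to it with fixed endpoints. For the Hamiltonian flow of `F` this is
the quantity `l(F)`, the distance from `𝟙` to the lift of `f_1` in the universal cover. -/
def homotopyLength (Ω : SymplecticForm n M) (f : ℝ → Diff n M) : ℝ :=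
  sInf {ℓ | ∃ g : ℝ → Diff n M, IsHamiltonianPath Ω g ∧ g 0 = f 0 ∧ g 1 = f 1 ∧
    AreHomotopic Ω f g ∧ HasLength Ω g ℓ}

/-- The space `ℱ` of smooth normalized Hamiltonians `M × ℝ → ℝ` which are 1-periodic in time. -/
def periodicHamiltonians (Ω : SymplecticForm n M) : Set (ℝ → M → ℝ) :=
  {F | IsNormalizedHamiltonian Ω univ F ∧ ∀ t x, F (t + 1) x = F t x}

/-- The set `ℋ` of those `H ∈ ℱ` which generate loops: the Hamiltonian flow of `H` has time-one
map `𝟙`. -/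
def loopHamiltonians (Ω : SymplecticForm n M) : Set (ℝ → M → ℝ) :=
  {H | H ∈ periodicHamiltonians Ω ∧ ∃ h : ℝ → Diff n M, IsHamiltonianFlow Ω univ H h ∧
    h 1 = Diffeomorph.refl (𝓡 (2 * n)) M ∞}

/-- The set `ℋ_c` of those `H ∈ ℋ` which generate contractible loops. -/
def contractibleLoopHamiltonians (Ω : SymplecticForm n M) : Set (ℝ → M → ℝ) :=
  {H | H ∈ periodicHamiltonians Ω ∧ ∃ h : ℝ → Diff n M, IsHamiltonianFlow Ω univ H h ∧
    h 1 = Diffeomorph.refl (𝓡 (2 * n)) M ∞ ∧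
    AreHomotopic Ω h fun _ => Diffeomorph.refl (𝓡 (2 * n)) M ∞}

end Hofer

end

/-!
Paths from `𝟙` to `f_1` and loops at `𝟙` correspond to each other through `f`: if `h` is a loop,
then `g_t = h_t⁻¹ ∘ f_t` is a path from `𝟙` to `f_1`, and conversely a path `g` gives the loop
`h_t = f_t ∘ g_t⁻¹`. The Hamiltonian `G` of `g` and the Hamiltonian `H` of `h` are related by
`G_t = (F_t - H_t) ∘ h_t`, so that `‖G_t‖ = ‖F_t - H_t‖`.

Given a loop, the length `∫ ‖F_t - H_t‖ dt` of `g` is at most `|||F - H|||`, whence the infimum over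
loops is at least the distance (`IsNormalizedFlow.symm_trans`, `integral_osc_le_uniformNorm`). Given
a path `g` of length `ℓ` and `ε > 0`, one first replaces `g` by `t ↦ g_{c(t)}`, where `c` is
an approximate arc length parameter which is constant near `0` and `1`
(`exists_arc_length_reparam`). This path has speed `‖G_t‖ ≤ ℓ + ε` at every time, and because it is
stationary near its endpoints it extends to a smooth path on `ℝ` with `g_{t+1} = g_t ∘ g_1` and
a 1-periodic Hamiltonian (`isNormalizedFlow_periodicExtension`). The corresponding loop has
a 1-periodic Hamiltonian `H` with `|||F - H||| ≤ ℓ + ε` (`exists_loop_of_path`). Homotopies from `f`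
to `g` correspond in the same way to contractions of `h` (`areHomotopic_trans_symm`,
`areHomotopic_refl_of_areHomotopic`).

This rests on the calculus of Hamiltonian isotopies: they are closed under composition and inversion
(`IsNormalizedFlow.trans`, `IsNormalizedFlow.symm`). Inverses depend smoothly on the parameters
(`contMDiffOn_symm_family`), and, when `M` is closed, the Hamiltonians obtained in this way have
mean zero because Hamiltonian diffeomorphisms preserve the symplectic form
(`isSymplecticMap_of_generates`) and the volume (`measurePreserving_symplecticVolume`). The identity
`f_{t+1} = f_t ∘ f_1` for periodic `F` comes from the uniqueness of flows
(`IsNormalizedFlow.unique`).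
-/

noncomputable section

namespace Hofer

open Filter Topology

/-! ### Smoothness of the inverses of a family of diffeomorphisms -/

section InverseFamilies

/-- A continuous map `g` with `Φ ∘ g = id`, where the derivative of `Φ` is invertible, is smooth.
This is the regularity part of the inverse function theorem on sets which need not be open, such as
products with a closed time interval. -/
theorem contDiffOn_of_leftInvOn {X Y : Type*} [NormedAddCommGroup X] [NormedSpace ℝ X]
    [NormedAddCommGroup Y] [NormedSpace ℝ Y] [CompleteSpace X] {Φ : X → Y} {g : Y → X}
    {D : Set X} {D' : Set Y} (hD : UniqueDiffOn ℝ D) (hD' : UniqueDiffOn ℝ D')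
    (hΦ : ContDiffOn ℝ ∞ Φ D) (hg : ContinuousOn g D') (hmaps : MapsTo g D' D)
    (hinv : ∀ y ∈ D', Φ (g y) = y)
    (hder : ∀ x ∈ D, (fderivWithin ℝ Φ D x).IsInvertible) : ContDiffOn ℝ ∞ g D' := by
  have hΦ' : ContDiffOn ℝ ∞ (fderivWithin ℝ Φ D) D := hΦ.fderivWithin hD (by simp)
  have key : ∀ y ∈ D', HasFDerivWithinAt g
      ((fderivWithin ℝ Φ D (g y)).inverse) D' y := by
    intro y hy
    obtain ⟨e, he⟩ := hder (g y) (hmaps hy)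
    rw [← he, ContinuousLinearMap.inverse_equiv]
    refine HasFDerivWithinAt.of_local_left_inverse (t := D) (f := Φ) ?_ ?_ hy ?_
    · exact tendsto_nhdsWithin_iff.2 ⟨hg y hy, eventually_mem_nhdsWithin.mono hmaps⟩
    · rw [he]
      exact ((hΦ.differentiableOn (by simp)) _ (hmaps hy)).hasFDerivWithinAt
    · exact eventually_mem_nhdsWithin.mono hinv
  rw [contDiffOn_infty]
  intro m
  induction m with
  | zero => exact contDiffOn_zero.2 hg
  | succ m ih =>
    have : ((m + 1 : ℕ) : WithTop ℕ∞) = (m : WithTop ℕ∞) + 1 := by push_cast; rfl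
    rw [this, contDiffOn_succ_iff_hasFDerivWithinAt_of_uniqueDiffOn hD']
    refine ⟨fun h => absurd h (by simp), _, ?_, key⟩
    intro y hy
    have h1 : ContDiffWithinAt ℝ m (fun y => fderivWithin ℝ Φ D (g y)) D' y :=
      ((hΦ'.of_le (by exact_mod_cast le_top)).comp ih hmaps) y hy
    exact ((hder (g y) (hmaps hy)).contDiffAt_map_inverse).comp_contDiffWithinAt y h1

variable {n : ℕ} {M : Type*} [TopologicalSpace M] [ChartedSpace (Model n) M]

/-- The inverses of a continuous family of diffeomorphisms with supports in a common compact set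
form a continuous family: the preimages of points of a compact set stay in a compact set, and their
limits are determined by injectivity. -/
theorem continuousOn_symm_family {P : Type*} [TopologicalSpace P] [T2Space M] {S : Set P}
    {φ : P → Diff n M}
    (hφ : ContinuousOn (fun q : M × P => φ q.2 q.1) (univ ×ˢ S)) {K : Set M} (hK : IsCompact K)
    (hsupp : ∀ p ∈ S, closure {x | φ p x ≠ x} ⊆ K) :
    ContinuousOn (fun q : M × P => (φ q.2).symm q.1) (univ ×ˢ S) := by
  have : LocallyCompactSpace M := ChartedSpace.locallyCompactSpace (Model n) M
  rintro ⟨y₀, p₀⟩ ⟨-, hp₀⟩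
  obtain ⟨N, hN, hNy⟩ := exists_compact_mem_nhds y₀
  have hfix : ∀ p ∈ S, ∀ y, (φ p).symm y ∈ K ∪ {y} := by
    intro p hp y
    by_cases h : (φ p).symm y = y
    · right; exact h
    · left
      refine hsupp p hp (subset_closure ?_)
      simpa [eq_comm] using h
  refine tendsto_iff_ultrafilter _ _ _ |>.2 fun U hU => ?_
  have hUS : ∀ᶠ q in (U : Filter (M × P)), q ∈ (univ : Set M) ×ˢ S :=
    hU eventually_mem_nhdsWithin
  have hU' : (U : Filter (M × P)) ≤ 𝓝 (y₀, p₀) := hU.trans nhdsWithin_le_nhds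
  have hU1 : Tendsto Prod.fst (U : Filter (M × P)) (𝓝 y₀) :=
    (continuous_fst.tendsto _).mono_left hU'
  have hU2 : Tendsto Prod.snd (U : Filter (M × P)) (𝓝 p₀) :=
    (continuous_snd.tendsto _).mono_left hU'
  have hUK : ∀ᶠ q in (U : Filter (M × P)), (φ q.2).symm q.1 ∈ K ∪ N := by
    filter_upwards [hUS, hU1 hNy] with q hq hqN
    rcases hfix q.2 hq.2 q.1 with h | h
    · exact Or.inl h
    · exact Or.inr (by rw [mem_singleton_iff.1 h]; exact hqN)
  obtain ⟨x', -, hx'⟩ := (hK.union hN).ultrafilter_le_nhds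
    (U.map fun q : M × P => (φ q.2).symm q.1) (le_principal_iff.2 hUK)
  have hx'' : Tendsto (fun q : M × P => (φ q.2).symm q.1) U (𝓝 x') := hx'
  have h1 : Tendsto (fun q : M × P => φ q.2 ((φ q.2).symm q.1)) U (𝓝 (φ p₀ x')) := by
    refine (hφ (x', p₀) ⟨mem_univ _, hp₀⟩).tendsto.comp
      (f := fun q : M × P => ((φ q.2).symm q.1, q.2))
      (tendsto_nhdsWithin_iff.2 ⟨hx''.prodMk_nhds hU2, ?_⟩)
    filter_upwards [hUS] with q hq using ⟨mem_univ _, hq.2⟩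
  simp only [Diffeomorph.apply_symm_apply] at h1
  have h2 : φ p₀ x' = y₀ := tendsto_nhds_unique h1 hU1
  have h3 : (φ p₀).symm y₀ = x' := by rw [← h2, Diffeomorph.symm_apply_apply]
  show Tendsto _ _ (𝓝 ((φ p₀).symm y₀))
  rw [h3]
  exact hx''

/-- The identity of `F × G` is smooth from the model with corners of a vector space to that of
a product; `contMDiff_ofProd` is the converse. -/
theorem contMDiff_toProd (F G : Type*) [NormedAddCommGroup F] [NormedSpace ℝ F]
    [NormedAddCommGroup G] [NormedSpace ℝ G] :
    ContMDiff 𝓘(ℝ, F × G) (𝓘(ℝ, F).prod 𝓘(ℝ, G)) ∞ (fun q : F × G => q) :=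
  (contDiff_fst.contMDiff).prodMk (contDiff_snd.contMDiff)

theorem contMDiff_ofProd (F G : Type*) [NormedAddCommGroup F] [NormedSpace ℝ F]
    [NormedAddCommGroup G] [NormedSpace ℝ G] :
    ContMDiff (𝓘(ℝ, F).prod 𝓘(ℝ, G)) 𝓘(ℝ, F × G) ∞ (fun q : F × G => q) :=
  contMDiff_fst.prodMk_space contMDiff_snd

variable {P : Type*} [NormedAddCommGroup P] [NormedSpace ℝ P]

/-- If `(x, p) ↦ φ_p(x)` is smooth on `M × S` then its expression in charts, as a map from
`E × P` to `E`, is smooth. -/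
theorem contDiffOn_chart_family [IsManifold (𝓡 (2 * n)) ∞ M] {S : Set P} {φ : P → M → M}
    (hφ : ContMDiffOn ((𝓡 (2 * n)).prod 𝓘(ℝ, P)) (𝓡 (2 * n)) ∞
      (fun q : M × P => φ q.2 q.1) (univ ×ˢ S)) (x₀ y₀ : M) :
    ContDiffOn ℝ ∞ (fun q : Model n × P => extChartAt (𝓡 (2 * n)) y₀
        (φ q.2 ((extChartAt (𝓡 (2 * n)) x₀).symm q.1)))
      {q | q ∈ (extChartAt (𝓡 (2 * n)) x₀).target ×ˢ S ∧
        φ q.2 ((extChartAt (𝓡 (2 * n)) x₀).symm q.1) ∈ (extChartAt (𝓡 (2 * n)) y₀).source} := by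
  rw [← contMDiffOn_iff_contDiffOn]
  refine (contMDiffOn_extChartAt (x := y₀)).comp (t := (chartAt (Model n) y₀).source)
    (g := extChartAt (𝓡 (2 * n)) y₀)
    (f := fun q : Model n × P => φ q.2 ((extChartAt (𝓡 (2 * n)) x₀).symm q.1)) ?_ ?_
  · refine hφ.comp (f := fun q : Model n × P => ((extChartAt (𝓡 (2 * n)) x₀).symm q.1, q.2)) ?_ ?_
    · refine ContMDiffOn.prodMk ?_ contDiff_snd.contMDiff.contMDiffOn
      exact (contMDiffOn_extChartAt_symm x₀).comp contDiff_fst.contMDiff.contMDiffOn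
        (fun q hq => hq.1.1)
    · exact fun q hq => ⟨mem_univ _, hq.1.2⟩
  · intro q hq
    simpa using hq.2

/-- The domain of the coordinate expression in `contDiffOn_chart_family` is relatively open in
a set of unique differentiability. -/
theorem uniqueDiffOn_chart_family {S : Set P} (hS : UniqueDiffOn ℝ S) {φ : P → M → M}
    (hφ : ContinuousOn (fun q : M × P => φ q.2 q.1) (univ ×ˢ S)) (x₀ y₀ : M) :
    UniqueDiffOn ℝ {q : Model n × P | q ∈ (extChartAt (𝓡 (2 * n)) x₀).target ×ˢ S ∧
        φ q.2 ((extChartAt (𝓡 (2 * n)) x₀).symm q.1) ∈ (extChartAt (𝓡 (2 * n)) y₀).source} := by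
  have h : ContinuousOn (fun q : Model n × P => φ q.2 ((extChartAt (𝓡 (2 * n)) x₀).symm q.1))
      ((extChartAt (𝓡 (2 * n)) x₀).target ×ˢ S) := by
    refine hφ.comp (f := fun q : Model n × P => ((extChartAt (𝓡 (2 * n)) x₀).symm q.1, q.2)) ?_
      (fun q hq => ⟨mem_univ _, hq.2⟩)
    exact ((continuousOn_extChartAt_symm x₀).comp continuousOn_fst fun q hq => hq.1).prodMk
      continuousOn_snd
  obtain ⟨u, hu, hu'⟩ := continuousOn_iff'.1 h _ (isOpen_extChartAt_source (I := 𝓡 (2 * n)) y₀)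
  have h2 : {q : Model n × P | q ∈ (extChartAt (𝓡 (2 * n)) x₀).target ×ˢ S ∧
        φ q.2 ((extChartAt (𝓡 (2 * n)) x₀).symm q.1) ∈ (extChartAt (𝓡 (2 * n)) y₀).source}
      = ((extChartAt (𝓡 (2 * n)) x₀).target ×ˢ S) ∩ u := by
    rw [inter_comm, ← hu', inter_comm]
    rfl
  rw [h2]
  exact ((isOpen_extChartAt_target x₀).uniqueDiffOn.prod hS).inter hu

/-- The inverses of a smooth family of diffeomorphisms with supports in a common compact set form
a smooth family. In charts, `(x, p) ↦ (φ_p(x), p)` has an invertible derivative. -/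
theorem contMDiffOn_symm_family [T2Space M] [IsManifold (𝓡 (2 * n)) ∞ M] [FiniteDimensional ℝ P]
    {S : Set P} (hS : UniqueDiffOn ℝ S) {φ : P → Diff n M}
    (hφ : ContMDiffOn ((𝓡 (2 * n)).prod 𝓘(ℝ, P)) (𝓡 (2 * n)) ∞
      (fun q : M × P => φ q.2 q.1) (univ ×ˢ S)) {K : Set M} (hK : IsCompact K)
    (hsupp : ∀ p ∈ S, closure {x | φ p x ≠ x} ⊆ K) :
    ContMDiffOn ((𝓡 (2 * n)).prod 𝓘(ℝ, P)) (𝓡 (2 * n)) ∞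
      (fun q : M × P => (φ q.2).symm q.1) (univ ×ˢ S) := by
  have hcont := continuousOn_symm_family hφ.continuousOn hK hsupp
  rintro ⟨y₀, p₀⟩ ⟨-, hp₀⟩
  set x₀ := (φ p₀).symm y₀ with hx₀
  set ψ := extChartAt (𝓡 (2 * n)) x₀ with hψ
  set χ := extChartAt (𝓡 (2 * n)) y₀ with hχ
  set D : Set (Model n × P) := {q | q ∈ ψ.target ×ˢ S ∧ φ q.2 (ψ.symm q.1) ∈ χ.source} with hD
  set D' : Set (Model n × P) := {q | q ∈ χ.target ×ˢ S ∧ (φ q.2).symm (χ.symm q.1) ∈ ψ.source}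
    with hD'
  have hDu : UniqueDiffOn ℝ D :=
    uniqueDiffOn_chart_family (φ := fun p => φ p) hS hφ.continuousOn x₀ y₀
  have hDu' : UniqueDiffOn ℝ D' :=
    uniqueDiffOn_chart_family (φ := fun p => (φ p).symm) hS hcont y₀ x₀
  set a : Model n × P → Model n := fun q => χ (φ q.2 (ψ.symm q.1)) with ha
  have haD : ContDiffOn ℝ ∞ a D := contDiffOn_chart_family (φ := fun p => φ p) hφ x₀ y₀
  set g : Model n × P → Model n × P := fun q => (ψ ((φ q.2).symm (χ.symm q.1)), q.2) with hg
  have hinner : ContinuousOn (fun q : Model n × P => (φ q.2).symm (χ.symm q.1)) D' := by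
    refine hcont.comp (f := fun q : Model n × P => (χ.symm q.1, q.2)) ?_
      (fun q hq => ⟨mem_univ _, hq.1.2⟩)
    exact ((continuousOn_extChartAt_symm y₀).comp continuousOn_fst fun q hq => hq.1.1).prodMk
      continuousOn_snd
  have hgc : ContinuousOn g D' :=
    ((continuousOn_extChartAt x₀).comp hinner fun q hq => hq.2).prodMk continuousOn_snd
  have hmaps : MapsTo g D' D := by
    rintro ⟨w, p⟩ ⟨⟨hw, hp⟩, h⟩
    refine ⟨⟨ψ.map_source h, hp⟩, ?_⟩
    simp only [hg]
    rw [ψ.left_inv h, Diffeomorph.apply_symm_apply]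
    exact χ.map_target hw
  have hgs : ContDiffOn ℝ ∞ g D' := by
    refine contDiffOn_of_leftInvOn (Φ := fun q => (a q, q.2)) hDu hDu'
      (haD.prodMk contDiff_snd.contDiffOn) hgc hmaps ?_ ?_
    · rintro ⟨w, p⟩ ⟨⟨hw, hp⟩, h⟩
      simp only [hg, ha]
      rw [ψ.left_inv h, Diffeomorph.apply_symm_apply, χ.right_inv hw]
    · rintro ⟨z, p⟩ hzp
      have hda : HasFDerivWithinAt a (fderivWithin ℝ a D (z, p)) D (z, p) :=
        (haD.differentiableOn (by simp) _ hzp).hasFDerivWithinAt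
      have hdΦ := hda.prodMk (hasFDerivWithinAt_snd (𝕜 := ℝ) (s := D) (p := (z, p)))
      rw [hdΦ.fderivWithin (hDu _ hzp)]
      set A := fderivWithin ℝ a D (z, p)
      -- the slice of `a` at the parameter `p` has a differentiable left inverse
      have hslice : HasFDerivWithinAt (fun z' : Model n => a (z', p))
          (A.comp ((ContinuousLinearMap.id ℝ (Model n)).prod 0)) {z' | (z', p) ∈ D} z :=
        HasFDerivWithinAt.comp (g := a) (f := fun z' : Model n => (z', p)) (t := D) z hda
          ((hasFDerivAt_id z).prodMk (hasFDerivAt_const p z)).hasFDerivWithinAt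
          (fun z' hz' => hz')
      have hopen : {z' | (z', p) ∈ D} ∈ 𝓝 z := by
        have h1 : ContinuousOn (fun z' => φ p (ψ.symm z')) ψ.target :=
          (φ p).continuous.comp_continuousOn (continuousOn_extChartAt_symm x₀)
        have h2 := (h1.isOpen_inter_preimage (isOpen_extChartAt_target x₀)
          (isOpen_extChartAt_source (I := 𝓡 (2 * n)) y₀)).mem_nhds ⟨hzp.1.1, hzp.2⟩
        filter_upwards [h2] with z' hz' using ⟨⟨hz'.1, hzp.1.2⟩, hz'.2⟩
      have hslice' := hslice.hasFDerivAt hopen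
      have hB : DifferentiableAt ℝ (fun w => ψ ((φ p).symm (χ.symm w))) (a (z, p)) := by
        have h1 := contDiffOn_chart_family (P := P) (S := univ) (φ := fun _ => (φ p).symm)
          (((φ p).symm.contMDiff.comp contMDiff_fst).contMDiffOn) y₀ x₀
        have h2 : ContDiffOn ℝ ∞ (fun w => ψ ((φ p).symm (χ.symm w)))
            (χ.target ∩ (fun w => (φ p).symm (χ.symm w)) ⁻¹' ψ.source) :=
          h1.comp (f := fun w : Model n => (w, p)) (contDiff_id.prodMk contDiff_const).contDiffOn
            (fun w hw => ⟨⟨hw.1, mem_univ _⟩, hw.2⟩)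
        refine (h2.differentiableOn (by simp)).differentiableAt ?_
        have h3 : ContinuousOn (fun w => (φ p).symm (χ.symm w)) χ.target :=
          (φ p).symm.continuous.comp_continuousOn (continuousOn_extChartAt_symm y₀)
        refine (h3.isOpen_inter_preimage (isOpen_extChartAt_target y₀)
          (isOpen_extChartAt_source (I := 𝓡 (2 * n)) x₀)).mem_nhds ⟨χ.map_source hzp.2, ?_⟩
        simp only [ha, mem_preimage]
        rw [χ.left_inv hzp.2, Diffeomorph.symm_apply_apply]
        exact ψ.map_target hzp.1.1
      have hcomp := hB.hasFDerivAt.comp z hslice'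
      have hid : HasFDerivAt (fun z' : Model n => z')
          ((fderiv ℝ (fun w => ψ ((φ p).symm (χ.symm w))) (a (z, p))).comp
            (A.comp ((ContinuousLinearMap.id ℝ (Model n)).prod 0))) z := by
        refine hcomp.congr_of_eventuallyEq ?_
        filter_upwards [hopen] with z' hz'
        simp only [ha, Function.comp]
        rw [χ.left_inv hz'.2, Diffeomorph.symm_apply_apply, ψ.right_inv hz'.1.1]
      have huniq := hid.unique (hasFDerivAt_id z)
      have hinj : Function.Injective (A.prod (ContinuousLinearMap.snd ℝ (Model n) P)) := by
        rw [injective_iff_map_eq_zero]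
        rintro ⟨v, q⟩ hv
        simp only [ContinuousLinearMap.prod_apply, ContinuousLinearMap.coe_snd', Prod.mk_eq_zero]
          at hv
        obtain ⟨hv, rfl⟩ := hv
        have := congrArg (fun L => L v) huniq
        simp [hv] at this
        simp [← this]
      exact ⟨(LinearEquiv.ofInjectiveEndo
        (A.prod (ContinuousLinearMap.snd ℝ (Model n) P)).toLinearMap hinj).toContinuousLinearEquiv,
        by ext <;> simp⟩
  -- return to the manifold
  have hmemD' : (χ y₀, p₀) ∈ D' := by
    refine ⟨⟨mem_extChartAt_target y₀, hp₀⟩, ?_⟩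
    simp only [hχ, extChartAt_to_inv, ← hx₀]
    exact mem_extChartAt_source x₀
  have hev : ∀ᶠ q in 𝓝[univ ×ˢ S] (y₀, p₀), q ∈ (univ : Set M) ×ˢ S ∧ q.1 ∈ χ.source ∧
      (φ q.2).symm q.1 ∈ ψ.source := by
    refine eventually_mem_nhdsWithin.and (Eventually.and ?_ ?_)
    · exact nhdsWithin_le_nhds
        (continuous_fst.continuousAt.preimage_mem_nhds (extChartAt_source_mem_nhds y₀))
    · exact (hcont (y₀, p₀) ⟨mem_univ _, hp₀⟩).preimage_mem_nhdsWithin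
        (extChartAt_source_mem_nhds x₀)
  obtain ⟨W, hW, hWs⟩ := mem_nhdsWithin_iff_exists_mem_nhds_inter.1 hev
  have hsm : ContMDiffOn ((𝓡 (2 * n)).prod 𝓘(ℝ, P)) (𝓡 (2 * n)) ∞
      (fun q : M × P => ψ.symm (g (χ q.1, q.2)).1) (W ∩ univ ×ˢ S) := by
    refine (contMDiffOn_extChartAt_symm x₀).comp (t := ψ.target)
      (f := fun q : M × P => (g (χ q.1, q.2)).1) ?_ ?_
    · refine (contMDiffOn_iff_contDiffOn.2 hgs.fst).comp (t := D')
        (f := fun q : M × P => (χ q.1, q.2)) ?_ ?_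
      · refine ContMDiffOn.prodMk_space ?_ contMDiffOn_snd
        exact (contMDiffOn_extChartAt (x := y₀)).comp contMDiffOn_fst
          (fun q hq => by
            rw [← extChartAt_source (𝓡 (2 * n))]; exact (hWs hq).2.1)
      · intro q hq
        obtain ⟨h1, h2, h3⟩ := hWs hq
        refine ⟨⟨χ.map_source h2, h1.2⟩, ?_⟩
        simpa only [χ.left_inv h2] using h3
    · intro q hq
      obtain ⟨h1, h2, h3⟩ := hWs hq
      refine ψ.map_source ?_
      simpa only [χ.left_inv h2] using h3
  have hsm' := hsm (y₀, p₀) ⟨mem_of_mem_nhds hW, mem_univ _, hp₀⟩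
  have hcongr : ContMDiffWithinAt ((𝓡 (2 * n)).prod 𝓘(ℝ, P)) (𝓡 (2 * n)) ∞
      (fun q : M × P => (φ q.2).symm q.1) (W ∩ univ ×ˢ S) (y₀, p₀) := by
    refine hsm'.congr_of_mem (fun q hq => ?_) ⟨mem_of_mem_nhds hW, mem_univ _, hp₀⟩
    obtain ⟨h1, h2, h3⟩ := hWs hq
    simp only [hg]
    rw [χ.left_inv h2, ψ.left_inv h3]
  exact hcongr.mono_of_mem_nhdsWithin
    (inter_mem (mem_nhdsWithin_of_mem_nhds hW) self_mem_nhdsWithin)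

end InverseFamilies

/-! ### The Cartan formula for closed 2-forms -/

section Closedness

theorem two_le_infty : (2 : WithTop ℕ∞) ≤ ∞ :=
  WithTop.coe_le_coe.2 le_top

/-- If the pullback `η = U^*σ` of a closed 2-form to `E × ℝ` satisfies `η(v, ∂_t) = dK(v)` for all
vectors `v` tangent to the slices `t = const`, then `η(v, w)` does not depend on `t`. -/
theorem hasDerivAt_pullback_form {E F : Type*} [NormedAddCommGroup E] [NormedSpace ℝ E]
    [NormedAddCommGroup F] [NormedSpace ℝ F] {σ : F → F [⋀^Fin 2]→L[ℝ] ℝ} {U : E × ℝ → F}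
    {K : E × ℝ → ℝ} {z : E} {t : ℝ} (hU : ContDiffAt ℝ ∞ U (z, t))
    (hσ : DifferentiableAt ℝ σ (U (z, t))) (hclosed : extDeriv σ (U (z, t)) = 0)
    (hK : ContDiffAt ℝ ∞ K (z, t))
    (hUK : ∀ᶠ q in 𝓝 (z, t), ∀ v : E,
      σ (U q) ![fderiv ℝ U q (v, 0), fderiv ℝ U q (0, 1)] = fderiv ℝ K q (v, 0)) (v w : E) :
    HasDerivAt (fun s => σ (U (z, s)) ![fderiv ℝ U (z, s) (v, 0), fderiv ℝ U (z, s) (w, 0)])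
      0 t := by
  set η : E × ℝ → (E × ℝ) [⋀^Fin 2]→L[ℝ] ℝ :=
    fun q => (σ (U q)).compContinuousLinearMap (fderiv ℝ U q) with hη
  have happ : ∀ q a b, η q ![a, b] = σ (U q) ![fderiv ℝ U q a, fderiv ℝ U q b] := by
    intro q a b
    simp only [hη, ContinuousAlternatingMap.compContinuousLinearMap_apply]
    congr 1
    ext i; fin_cases i <;> rfl
  have hdU : DifferentiableAt ℝ (fderiv ℝ U) (z, t) :=
    (hU.fderiv_right (m := 1) (by rw [one_add_one_eq_two]; exact two_le_infty)).differentiableAt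
      (by simp)
  have hηd : DifferentiableAt ℝ η (z, t) :=
    (hσ.comp (z, t) (hU.differentiableAt (by simp))).continuousAlternatingMapCompContinuousLinearMap
      hdU
  have hdη : extDeriv η (z, t) = 0 := by
    rw [hη, extDeriv_pullback hσ hU (by simpa using two_le_infty), hclosed]
    ext; simp
  have hdη' := congrArg (fun L => L ![((0 : E), (1 : ℝ)), (v, 0), (w, 0)]) hdη
  have r0 : (0 : Fin 3).removeNth ![((0 : E), (1 : ℝ)), (v, 0), (w, 0)] = ![(v, 0), (w, 0)] := by
    ext i <;> fin_cases i <;> rfl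
  have r1 : (1 : Fin 3).removeNth ![((0 : E), (1 : ℝ)), (v, 0), (w, 0)] = ![(0, 1), (w, 0)] := by
    ext i <;> fin_cases i <;> rfl
  have r2 : (2 : Fin 3).removeNth ![((0 : E), (1 : ℝ)), (v, 0), (w, 0)] = ![(0, 1), (v, 0)] := by
    ext i <;> fin_cases i <;> rfl
  have hswap : ∀ a : E, (fun q => η q ![(0, 1), (a, 0)]) =ᶠ[𝓝 (z, t)]
      fun q => -(fderiv ℝ K q (a, 0)) := by
    intro a
    filter_upwards [hUK] with q hq
    rw [← hq a, ← happ]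
    have := (η q).map_swap ![((a, 0) : E × ℝ), (0, 1)] (i := 0) (j := 1) (by decide)
    refine Eq.trans ?_ this
    show η q _ = η q _
    congr 1
    ext i <;> fin_cases i <;> rfl
  have hdK : DifferentiableAt ℝ (fderiv ℝ K) (z, t) :=
    (hK.fderiv_right (m := 1) (by rw [one_add_one_eq_two]; exact two_le_infty)).differentiableAt
      (by simp)
  have hsnd : ∀ a b : E × ℝ, fderiv ℝ (fun q => -(fderiv ℝ K q a)) (z, t) b =
      -(fderiv ℝ (fderiv ℝ K) (z, t) b a) := by
    intro a b
    have := (hdK.hasFDerivAt.clm_apply (hasFDerivAt_const a (z, t))).neg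
    refine (DFunLike.congr_fun this.fderiv b).trans ?_
    simp
  rw [extDeriv_apply hηd, Fin.sum_univ_three] at hdη'
  simp only [r0, r1, r2, (hswap v).fderiv_eq, (hswap w).fderiv_eq] at hdη'
  simp only [Fin.isValue, Fin.coe_ofNat_eq_mod, Matrix.cons_val_zero, Matrix.cons_val_one,
    Matrix.cons_val, hsnd] at hdη'
  have hsymm : fderiv ℝ (fderiv ℝ K) (z, t) (v, 0) (w, 0) =
      fderiv ℝ (fderiv ℝ K) (z, t) (w, 0) (v, 0) :=
    (hK.isSymmSndFDerivAt (by simpa using two_le_infty)).eq _ _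
  have hzero : fderiv ℝ (fun q => η q ![(v, 0), (w, 0)]) (z, t) (0, 1) = 0 := by
    simp [hsymm] at hdη'
    linarith
  have hd : HasFDerivAt (fun q => η q ![(v, 0), (w, 0)])
      (fderiv ℝ (fun q => η q ![(v, 0), (w, 0)]) (z, t)) (z, t) :=
    (hηd.continuousAlternatingMap_apply_const _).hasFDerivAt
  have hline : HasDerivAt (fun s : ℝ => (z, s)) ((0 : E), (1 : ℝ)) t :=
    (hasDerivAt_const t z).prodMk (hasDerivAt_id t)
  have := hd.comp_hasDerivAt t hline
  rw [hzero] at this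
  exact this.congr_of_eventuallyEq (Eventually.of_forall fun s => (happ _ _ _).symm)

end Closedness

/-! ### Hamiltonian flows preserve the symplectic form -/

section SymplecticFlows

variable {n : ℕ} {M : Type*} [TopologicalSpace M] [ChartedSpace (Model n) M]

/-- A map which preserves the symplectic form. -/
def IsSymplecticMap (Ω : SymplecticForm n M) (φ : M → M) : Prop :=
  ∀ (x : M) (v w : TangentSpace (𝓡 (2 * n)) x),
    Ω.form (φ x) ![mfderiv (𝓡 (2 * n)) (𝓡 (2 * n)) φ x v, mfderiv (𝓡 (2 * n)) (𝓡 (2 * n)) φ x w] =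
      Ω.form x ![v, w]

theorem chartForm_apply (Ω : SymplecticForm n M) (x₀ : M) (z : Model n) (v w : Model n) :
    chartForm Ω.form x₀ z ![v, w] = Ω.form ((extChartAt (𝓡 (2 * n)) x₀).symm z)
      ![mfderiv 𝓘(ℝ, Model n) (𝓡 (2 * n)) (extChartAt (𝓡 (2 * n)) x₀).symm z v,
        mfderiv 𝓘(ℝ, Model n) (𝓡 (2 * n)) (extChartAt (𝓡 (2 * n)) x₀).symm z w] := by
  refine congrArg (Ω.form ((extChartAt (𝓡 (2 * n)) x₀).symm z)) ?_
  funext i; fin_cases i <;> rfl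

variable [IsManifold (𝓡 (2 * n)) ∞ M]

instance isManifold_one : IsManifold (𝓡 (2 * n)) 1 M :=
  IsManifold.of_le (n := ∞) (WithTop.coe_le_coe.2 le_top)

theorem mfderiv_symm_mfderiv_extChartAt (x₀ : M) {z : Model n}
    (hz : z ∈ (extChartAt (𝓡 (2 * n)) x₀).target)
    (v : TangentSpace (𝓡 (2 * n)) ((extChartAt (𝓡 (2 * n)) x₀).symm z)) :
    mfderiv 𝓘(ℝ, Model n) (𝓡 (2 * n)) (extChartAt (𝓡 (2 * n)) x₀).symm z
      (mfderiv (𝓡 (2 * n)) 𝓘(ℝ, Model n) (extChartAt (𝓡 (2 * n)) x₀)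
        ((extChartAt (𝓡 (2 * n)) x₀).symm z) v) = v := by
  have := mfderivWithin_extChartAt_symm_comp_mfderiv_extChartAt (I := 𝓡 (2 * n)) hz
  rw [ModelWithCorners.range_eq_univ, mfderivWithin_univ] at this
  exact congrArg (fun L => L v) this

theorem chartForm_extChartAt (Ω : SymplecticForm n M) (x₀ : M) {y : M}
    (hy : y ∈ (extChartAt (𝓡 (2 * n)) x₀).source) (v w : TangentSpace (𝓡 (2 * n)) y) :
    chartForm Ω.form x₀ (extChartAt (𝓡 (2 * n)) x₀ y)
      ![mfderiv (𝓡 (2 * n)) 𝓘(ℝ, Model n) (extChartAt (𝓡 (2 * n)) x₀) y v,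
        mfderiv (𝓡 (2 * n)) 𝓘(ℝ, Model n) (extChartAt (𝓡 (2 * n)) x₀) y w] =
      Ω.form y ![v, w] := by
  obtain ⟨z, hz, rfl⟩ : ∃ z ∈ (extChartAt (𝓡 (2 * n)) x₀).target,
      (extChartAt (𝓡 (2 * n)) x₀).symm z = y :=
    ⟨_, (extChartAt (𝓡 (2 * n)) x₀).map_source hy, (extChartAt (𝓡 (2 * n)) x₀).left_inv hy⟩
  rw [(extChartAt (𝓡 (2 * n)) x₀).right_inv hz]
  refine (chartForm_apply Ω x₀ z _ _).trans ?_
  exact congrArg₂ (fun a b : TangentSpace (𝓡 (2 * n)) ((extChartAt (𝓡 (2 * n)) x₀).symm z) =>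
    Ω.form _ ![a, b]) (mfderiv_symm_mfderiv_extChartAt x₀ hz v)
    (mfderiv_symm_mfderiv_extChartAt x₀ hz w)

theorem hasMFDerivAt_extChartAt (y₀ : M) {y : M} (hy : y ∈ (extChartAt (𝓡 (2 * n)) y₀).source) :
    HasMFDerivAt (𝓡 (2 * n)) 𝓘(ℝ, Model n) (extChartAt (𝓡 (2 * n)) y₀) y
      (mfderiv (𝓡 (2 * n)) 𝓘(ℝ, Model n) (extChartAt (𝓡 (2 * n)) y₀) y) := by
  rw [extChartAt_source] at hy
  exact (mdifferentiableAt_extChartAt hy).hasMFDerivAt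

theorem hasMFDerivAt_extChartAt_symm (x₀ : M) {z : Model n}
    (hz : z ∈ (extChartAt (𝓡 (2 * n)) x₀).target) :
    HasMFDerivAt 𝓘(ℝ, Model n) (𝓡 (2 * n)) (extChartAt (𝓡 (2 * n)) x₀).symm z
      (mfderiv 𝓘(ℝ, Model n) (𝓡 (2 * n)) (extChartAt (𝓡 (2 * n)) x₀).symm z) := by
  have h := (contMDiffOn_extChartAt_symm (I := 𝓡 (2 * n)) (n := ∞) x₀).contMDiffAt
    ((isOpen_extChartAt_target x₀).mem_nhds hz)
  exact (h.mdifferentiableAt (by simp)).hasMFDerivAt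

/-- The derivative of the expression of `φ : M → M` in the charts around `x₀` and `y₀`. -/
theorem hasFDerivAt_chart_expression {φ : M → M} (hφ : ContMDiff (𝓡 (2 * n)) (𝓡 (2 * n)) ∞ φ)
    (x₀ y₀ : M) {z : Model n} (hz : z ∈ (extChartAt (𝓡 (2 * n)) x₀).target)
    (h : φ ((extChartAt (𝓡 (2 * n)) x₀).symm z) ∈ (extChartAt (𝓡 (2 * n)) y₀).source) :
    HasFDerivAt (fun z' => extChartAt (𝓡 (2 * n)) y₀ (φ ((extChartAt (𝓡 (2 * n)) x₀).symm z')))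
      ((mfderiv (𝓡 (2 * n)) 𝓘(ℝ, Model n) (extChartAt (𝓡 (2 * n)) y₀)
          (φ ((extChartAt (𝓡 (2 * n)) x₀).symm z))).comp
        ((mfderiv (𝓡 (2 * n)) (𝓡 (2 * n)) φ ((extChartAt (𝓡 (2 * n)) x₀).symm z)).comp
          (mfderiv 𝓘(ℝ, Model n) (𝓡 (2 * n)) (extChartAt (𝓡 (2 * n)) x₀).symm z)) :
        Model n →L[ℝ] Model n) z := by
  have h1 := ((hφ.mdifferentiable (by simp)) ((extChartAt (𝓡 (2 * n)) x₀).symm z)).hasMFDerivAt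
  have h2 := h1.comp z (hasMFDerivAt_extChartAt_symm x₀ hz)
  exact ((hasMFDerivAt_extChartAt y₀ h).comp z h2).hasFDerivAt

/-- The spatial part of the derivative of a smooth family of maps in charts. -/
theorem fderivWithin_chart_family_apply {S : Set ℝ} {φ : ℝ → M → M}
    (hφ : ContMDiffOn ((𝓡 (2 * n)).prod 𝓘(ℝ, ℝ)) (𝓡 (2 * n)) ∞
      (fun q : M × ℝ => φ q.2 q.1) (univ ×ˢ S)) (x₀ y₀ : M) {z : Model n} {t : ℝ}
    (hφt : ContMDiff (𝓡 (2 * n)) (𝓡 (2 * n)) ∞ (φ t))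
    (hz : z ∈ (extChartAt (𝓡 (2 * n)) x₀).target) (ht : t ∈ S)
    (h : φ t ((extChartAt (𝓡 (2 * n)) x₀).symm z) ∈ (extChartAt (𝓡 (2 * n)) y₀).source)
    (v : Model n) :
    fderivWithin ℝ (fun q : Model n × ℝ => extChartAt (𝓡 (2 * n)) y₀
        (φ q.2 ((extChartAt (𝓡 (2 * n)) x₀).symm q.1)))
      {q | q ∈ (extChartAt (𝓡 (2 * n)) x₀).target ×ˢ S ∧
        φ q.2 ((extChartAt (𝓡 (2 * n)) x₀).symm q.1) ∈ (extChartAt (𝓡 (2 * n)) y₀).source}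
      (z, t) (v, 0) =
    mfderiv (𝓡 (2 * n)) 𝓘(ℝ, Model n) (extChartAt (𝓡 (2 * n)) y₀)
        (φ t ((extChartAt (𝓡 (2 * n)) x₀).symm z))
      (mfderiv (𝓡 (2 * n)) (𝓡 (2 * n)) (φ t) ((extChartAt (𝓡 (2 * n)) x₀).symm z)
        (mfderiv 𝓘(ℝ, Model n) (𝓡 (2 * n)) (extChartAt (𝓡 (2 * n)) x₀).symm z v)) := by
  set D := {q : Model n × ℝ | q ∈ (extChartAt (𝓡 (2 * n)) x₀).target ×ˢ S ∧
        φ q.2 ((extChartAt (𝓡 (2 * n)) x₀).symm q.1) ∈ (extChartAt (𝓡 (2 * n)) y₀).source} with hD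
  set U := fun q : Model n × ℝ => extChartAt (𝓡 (2 * n)) y₀
        (φ q.2 ((extChartAt (𝓡 (2 * n)) x₀).symm q.1)) with hU
  have hzt : (z, t) ∈ D := ⟨⟨hz, ht⟩, h⟩
  have hdU : HasFDerivWithinAt U (fderivWithin ℝ U D (z, t)) D (z, t) :=
    ((contDiffOn_chart_family hφ x₀ y₀).differentiableOn (by simp) _ hzt).hasFDerivWithinAt
  have hslice : HasFDerivWithinAt (fun z' : Model n => U (z', t))
      ((fderivWithin ℝ U D (z, t)).comp ((ContinuousLinearMap.id ℝ (Model n)).prod 0))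
      {z' | (z', t) ∈ D} z :=
    HasFDerivWithinAt.comp (g := U) (f := fun z' : Model n => (z', t)) (t := D) z hdU
      ((hasFDerivAt_id z).prodMk (hasFDerivAt_const t z)).hasFDerivWithinAt (fun z' hz' => hz')
  have hopen : {z' | (z', t) ∈ D} ∈ 𝓝 z := by
    have h1 : ContinuousOn (fun z' => φ t ((extChartAt (𝓡 (2 * n)) x₀).symm z'))
        (extChartAt (𝓡 (2 * n)) x₀).target :=
      hφt.continuous.comp_continuousOn (continuousOn_extChartAt_symm x₀)
    have h2 := (h1.isOpen_inter_preimage (isOpen_extChartAt_target x₀)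
      (isOpen_extChartAt_source (I := 𝓡 (2 * n)) y₀)).mem_nhds ⟨hz, h⟩
    filter_upwards [h2] with z' hz' using ⟨⟨hz'.1, ht⟩, hz'.2⟩
  have huniq := (hslice.hasFDerivAt hopen).unique (hasFDerivAt_chart_expression hφt x₀ y₀ hz h)
  exact DFunLike.congr_fun huniq v

/-- Along a family generated by a Hamiltonian `A` the form `φ_t^*Ω` is constant: in charts, the
closedness of `Ω` and `i_{sgrad A} Ω = -dA` give `d/dt φ_t^*Ω = 0` inside the time interval, and
`φ_t^*Ω` is continuous up to its ends. -/
theorem isSymplecticMap_of_generates (Ω : SymplecticForm n M) {J : Set ℝ} (hJ : UniqueDiffOn ℝ J)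
    (hJc : J.OrdConnected) {a : ℝ → Diff n M} {A : ℝ → M → ℝ}
    (ha : ContMDiffOn ((𝓡 (2 * n)).prod 𝓘(ℝ, ℝ)) (𝓡 (2 * n)) ∞
      (fun q : M × ℝ => a q.2 q.1) (univ ×ˢ J))
    (hA : ContMDiffOn ((𝓡 (2 * n)).prod 𝓘(ℝ, ℝ)) 𝓘(ℝ, ℝ) ∞
      (fun q : M × ℝ => A q.2 q.1) (univ ×ˢ J))
    (hgen : Generates Ω J A a) {t₀ : ℝ} (ht₀ : t₀ ∈ J) (h₀ : IsSymplecticMap Ω (a t₀)) {t : ℝ}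
    (ht : t ∈ J) : IsSymplecticMap Ω (a t) := by
  have hat : ∀ s, ContMDiff (𝓡 (2 * n)) (𝓡 (2 * n)) ∞ (fun x => a s x) := fun s => (a s).contMDiff
  intro x
  obtain ⟨x₀, z, hz, rfl⟩ : ∃ (x₀ : M) (z : Model n), z ∈ (extChartAt (𝓡 (2 * n)) x₀).target ∧
      (extChartAt (𝓡 (2 * n)) x₀).symm z = x :=
    ⟨x, _, mem_extChartAt_target x, extChartAt_to_inv x⟩
  set ψ := extChartAt (𝓡 (2 * n)) x₀ with hψ
  intro v w
  obtain ⟨v', hv⟩ : ∃ v' : Model n, mfderiv 𝓘(ℝ, Model n) (𝓡 (2 * n)) ψ.symm z v' = v :=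
    ⟨_, mfderiv_symm_mfderiv_extChartAt x₀ hz v⟩
  obtain ⟨w', hw⟩ : ∃ w' : Model n, mfderiv 𝓘(ℝ, Model n) (𝓡 (2 * n)) ψ.symm z w' = w :=
    ⟨_, mfderiv_symm_mfderiv_extChartAt x₀ hz w⟩
  set f : ℝ → ℝ := fun s => Ω.form (a s (ψ.symm z))
    ![mfderiv (𝓡 (2 * n)) (𝓡 (2 * n)) (a s) (ψ.symm z)
        (mfderiv 𝓘(ℝ, Model n) (𝓡 (2 * n)) ψ.symm z v'),
      mfderiv (𝓡 (2 * n)) (𝓡 (2 * n)) (a s) (ψ.symm z)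
        (mfderiv 𝓘(ℝ, Model n) (𝓡 (2 * n)) ψ.symm z w')] with hf
  have hcurve : ContinuousOn (fun s => a s (ψ.symm z)) J :=
    ha.continuousOn.comp (f := fun s => (ψ.symm z, s)) (by fun_prop) fun s hs => ⟨mem_univ _, hs⟩
  have key : ∀ t₁ ∈ J, ContinuousWithinAt f J t₁ ∧ (t₁ ∈ interior J → HasDerivAt f 0 t₁) := by
    intro t₁ ht₁
    set y₀ := a t₁ (ψ.symm z) with hy₀
    set χ := extChartAt (𝓡 (2 * n)) y₀ with hχ
    set D : Set (Model n × ℝ) := {q | q ∈ ψ.target ×ˢ J ∧ a q.2 (ψ.symm q.1) ∈ χ.source} with hD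
    set U : Model n × ℝ → Model n := fun q => χ (a q.2 (ψ.symm q.1)) with hU
    have hUD : ContDiffOn ℝ ∞ U D := contDiffOn_chart_family (φ := fun s => a s) ha x₀ y₀
    have hDu : UniqueDiffOn ℝ D :=
      uniqueDiffOn_chart_family (φ := fun s => a s) hJ ha.continuousOn x₀ y₀
    have hdU : ContDiffOn ℝ ∞ (fderivWithin ℝ U D) D := hUD.fderivWithin hDu (by simp)
    have hmem₁ : (z, t₁) ∈ D := ⟨⟨hz, ht₁⟩, mem_extChartAt_source y₀⟩
    have hspace : ∀ q ∈ D, ∀ u : Model n, fderivWithin ℝ U D q (u, 0) =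
        mfderiv (𝓡 (2 * n)) 𝓘(ℝ, Model n) χ (a q.2 (ψ.symm q.1))
          (mfderiv (𝓡 (2 * n)) (𝓡 (2 * n)) (a q.2) (ψ.symm q.1)
            (mfderiv 𝓘(ℝ, Model n) (𝓡 (2 * n)) ψ.symm q.1 u)) := by
      rintro ⟨z', s⟩ hq u
      exact fderivWithin_chart_family_apply (φ := fun s => a s) ha x₀ y₀ (hat s) hq.1.1 hq.1.2
        hq.2 u
    have hfU : ∀ s, (z, s) ∈ D → f s = chartForm Ω.form y₀ (U (z, s))
        ![fderivWithin ℝ U D (z, s) (v', 0), fderivWithin ℝ U D (z, s) (w', 0)] := by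
      intro s hs
      rw [hspace _ hs, hspace _ hs]
      exact (chartForm_extChartAt Ω y₀ hs.2 _ _).symm
    have hUtarget : ∀ q ∈ D, U q ∈ χ.target := fun q hq => χ.map_source hq.2
    have hform : ∀ q ∈ D, ContDiffAt ℝ ∞ (chartForm Ω.form y₀) (U q) := fun q hq =>
      (Ω.smooth y₀).contDiffAt ((isOpen_extChartAt_target y₀).mem_nhds (hUtarget q hq))
    have hev : ∀ᶠ s in 𝓝[J] t₁, (z, s) ∈ D := by
      filter_upwards [eventually_mem_nhdsWithin, (hcurve t₁ ht₁).preimage_mem_nhdsWithin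
        (extChartAt_source_mem_nhds (I := 𝓡 (2 * n)) y₀)] with s hs hs' using ⟨⟨hz, hs⟩, hs'⟩
    constructor
    · have hline : ContDiffWithinAt ℝ ∞ (fun s : ℝ => (z, s)) {s | (z, s) ∈ D} t₁ := by fun_prop
      have h1 : DifferentiableWithinAt ℝ (fun s => chartForm Ω.form y₀ (U (z, s)))
          {s | (z, s) ∈ D} t₁ :=
        (ContDiffAt.comp_contDiffWithinAt (g := chartForm Ω.form y₀) (f := fun s => U (z, s)) t₁
          (hform _ hmem₁) ((hUD _ hmem₁).comp t₁ hline
            (fun s hs => hs))).differentiableWithinAt (by simp)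
      have h2 : DifferentiableWithinAt ℝ (fun s => fderivWithin ℝ U D (z, s))
          {s | (z, s) ∈ D} t₁ :=
        ((hdU _ hmem₁).comp t₁ hline (fun s hs => hs)).differentiableWithinAt (by simp)
      have h3 : DifferentiableWithinAt ℝ (fun s => chartForm Ω.form y₀ (U (z, s))
          ![fderivWithin ℝ U D (z, s) (v', 0), fderivWithin ℝ U D (z, s) (w', 0)])
          {s | (z, s) ∈ D} t₁ := by
        refine DifferentiableWithinAt.continuousAlternatingMap_apply h1
          (g := fun i s => (![fderivWithin ℝ U D (z, s) (v', 0),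
            fderivWithin ℝ U D (z, s) (w', 0)] : Fin 2 → Model n) i) ?_
        intro i
        fin_cases i
        · exact h2.clm_apply (differentiableWithinAt_const _)
        · exact h2.clm_apply (differentiableWithinAt_const _)
      have h4 : ContinuousWithinAt f {s | (z, s) ∈ D} t₁ :=
        h3.continuousWithinAt.congr (fun s hs => hfU s hs) (hfU t₁ hmem₁)
      exact h4.mono_of_mem_nhdsWithin hev
    · intro hint
      set D' : Set (Model n × ℝ) :=
        (ψ.target ×ˢ interior J) ∩ (fun q => a q.2 (ψ.symm q.1)) ⁻¹' χ.source with hD'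
      have hD'o : IsOpen D' := by
        refine ContinuousOn.isOpen_inter_preimage ?_
          ((isOpen_extChartAt_target x₀).prod isOpen_interior) (isOpen_extChartAt_source y₀)
        refine ha.continuousOn.comp (f := fun q : Model n × ℝ => (ψ.symm q.1, q.2)) ?_
          fun q hq => ⟨mem_univ _, interior_subset hq.2⟩
        exact ((continuousOn_extChartAt_symm x₀).comp continuousOn_fst fun q hq => hq.1).prodMk
          continuousOn_snd
      have hD'D : D' ⊆ D := fun q hq => ⟨⟨hq.1.1, interior_subset hq.1.2⟩, hq.2⟩
      have hDn : ∀ q ∈ D', D ∈ 𝓝 q := fun q hq => mem_of_superset (hD'o.mem_nhds hq) hD'D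
      have hmem' : (z, t₁) ∈ D' := ⟨⟨hz, hint⟩, mem_extChartAt_source y₀⟩
      have hfd : ∀ q ∈ D', fderivWithin ℝ U D q = fderiv ℝ U q := fun q hq =>
        fderivWithin_of_mem_nhds (hDn q hq)
      set K : Model n × ℝ → ℝ := fun q => A q.2 (a q.2 (ψ.symm q.1)) with hK
      have hKD : ContDiffOn ℝ ∞ K D := by
        rw [← contMDiffOn_iff_contDiffOn]
        refine hA.comp (f := fun q : Model n × ℝ => (a q.2 (ψ.symm q.1), q.2)) ?_
          fun q hq => ⟨mem_univ _, hq.1.2⟩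
        refine ContMDiffOn.prodMk ?_ contDiff_snd.contMDiff.contMDiffOn
        refine ha.comp (f := fun q : Model n × ℝ => (ψ.symm q.1, q.2)) ?_
          fun q hq => ⟨mem_univ _, hq.1.2⟩
        refine ContMDiffOn.prodMk ?_ contDiff_snd.contMDiff.contMDiffOn
        exact (contMDiffOn_extChartAt_symm x₀).comp contDiff_fst.contMDiff.contMDiffOn
          (fun q hq => hq.1.1)
      have hUK : ∀ q ∈ D', ∀ u : Model n,
          chartForm Ω.form y₀ (U q) ![fderiv ℝ U q (u, 0), fderiv ℝ U q (0, 1)] =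
            fderiv ℝ K q (u, 0) := by
        rintro ⟨z', s⟩ hq u
        have hJs : J ∈ 𝓝 s := mem_interior_iff_mem_nhds.1 hq.1.2
        obtain ⟨ξ, hξ, hξd⟩ := hgen s (interior_subset hq.1.2) (ψ.symm z')
        have htime : fderiv ℝ U (z', s) (0, 1) =
            mfderiv (𝓡 (2 * n)) 𝓘(ℝ, Model n) χ (a s (ψ.symm z')) ξ := by
          have h1 := ((hasMFDerivAt_extChartAt y₀ hq.2).comp s
            (hξd.hasMFDerivAt hJs)).hasFDerivAt
          have h2 : HasFDerivAt (fun r : ℝ => U (z', r)) ((fderiv ℝ U (z', s)).comp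
              ((0 : ℝ →L[ℝ] Model n).prod (ContinuousLinearMap.id ℝ ℝ))) s :=
            HasFDerivAt.comp (g := U) (f := fun r : ℝ => (z', r)) s
              ((hUD.contDiffAt (hDn _ hq)).differentiableAt (by simp)).hasFDerivAt
              ((hasFDerivAt_const z' s).prodMk (hasFDerivAt_id s))
          refine (DFunLike.congr_fun (h2.unique h1) (1 : ℝ)).trans ?_
          exact congrArg (mfderiv (𝓡 (2 * n)) 𝓘(ℝ, Model n) χ (a s (ψ.symm z'))) (one_smul ℝ ξ)
        have hAs : MDifferentiableAt (𝓡 (2 * n)) 𝓘(ℝ, ℝ) (A s) (a s (ψ.symm z')) := by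
          have h1 : ContMDiff (𝓡 (2 * n)) 𝓘(ℝ, ℝ) ∞ (A s) := by
            rw [← contMDiffOn_univ]
            exact hA.comp (f := fun y : M => (y, s))
              (contMDiff_id.prodMk contMDiff_const).contMDiffOn
              fun y _ => ⟨mem_univ _, interior_subset hq.1.2⟩
          exact h1.mdifferentiable (by simp) _
        have hKs : fderiv ℝ K (z', s) (u, 0) = mfderiv (𝓡 (2 * n)) 𝓘(ℝ, ℝ) (A s) (a s (ψ.symm z'))
            (mfderiv (𝓡 (2 * n)) (𝓡 (2 * n)) (a s) (ψ.symm z')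
              (mfderiv 𝓘(ℝ, Model n) (𝓡 (2 * n)) ψ.symm z' u)) := by
          have h1 : HasFDerivAt (fun y : Model n => K (y, s)) ((fderiv ℝ K (z', s)).comp
              ((ContinuousLinearMap.id ℝ (Model n)).prod (0 : Model n →L[ℝ] ℝ))) z' :=
            HasFDerivAt.comp (g := K) (f := fun y : Model n => (y, s)) z'
              ((hKD.contDiffAt (hDn _ hq)).differentiableAt (by simp)).hasFDerivAt
              ((hasFDerivAt_id z').prodMk (hasFDerivAt_const s z'))
          have h2 := (hAs.hasMFDerivAt.comp z' ((((hat s).mdifferentiable (by simp))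
            (ψ.symm z')).hasMFDerivAt.comp z'
              (hasMFDerivAt_extChartAt_symm x₀ hq.1.1))).hasFDerivAt
          exact DFunLike.congr_fun (h1.unique h2) u
        rw [← hfd _ hq, hspace _ (hD'D hq) u, hfd _ hq, htime, hKs]
        refine (chartForm_extChartAt Ω y₀ hq.2 _ _).trans ?_
        have hsw := (Ω.form (a s (ψ.symm z'))).map_swap (i := 0) (j := 1)
          ![ξ, mfderiv (𝓡 (2 * n)) (𝓡 (2 * n)) (a s) (ψ.symm z')
              (mfderiv 𝓘(ℝ, Model n) (𝓡 (2 * n)) ψ.symm z' u)] (by decide)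
        have hsw' := (hsw.trans (congrArg Neg.neg (hξ _))).trans (neg_neg (G := ℝ) _)
        refine Eq.trans ?_ hsw'
        refine congrArg (Ω.form (a s (ψ.symm z'))) ?_
        funext i; fin_cases i <;> rfl
      have hmain := hasDerivAt_pullback_form (hUD.contDiffAt (hDn _ hmem'))
        ((hform _ hmem₁).differentiableAt (by simp)) (Ω.closed y₀ _ (hUtarget _ hmem₁))
        (hKD.contDiffAt (hDn _ hmem'))
        (mem_of_superset (hD'o.mem_nhds hmem') hUK) v' w'
      refine hmain.congr_of_eventuallyEq ?_
      have hline : Tendsto (fun s : ℝ => (z, s)) (𝓝 t₁) (𝓝 (z, t₁)) :=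
        (Continuous.prodMk_right z).tendsto t₁
      filter_upwards [hline (hD'o.mem_nhds hmem')] with s hs
      rw [hfU s (hD'D hs), hfd _ hs]
  -- a function on an interval, continuous and with zero derivative inside, is constant
  have hmono : ∀ t₁ ∈ J, ∀ t₂ ∈ J, t₁ < t₂ → f t₁ = f t₂ := by
    intro t₁ ht₁ t₂ ht₂ hlt
    have hsub : Icc t₁ t₂ ⊆ J := hJc.out ht₁ ht₂
    obtain ⟨c, hc, hc'⟩ := exists_hasDerivAt_eq_slope f (fun _ => 0) hlt
      (fun s hs => (key s (hsub hs)).1.mono hsub)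
      (fun s hs => (key s (hsub (Ioo_subset_Icc_self hs))).2
        (interior_maximal (Ioo_subset_Icc_self.trans hsub) isOpen_Ioo hs))
    have := (div_eq_zero_iff.1 hc'.symm).resolve_right (sub_pos.2 hlt).ne'
    linarith
  have hconst : f t = f t₀ := by
    rcases lt_trichotomy t t₀ with h | rfl | h
    · exact hmono t ht t₀ ht₀ h
    · rfl
    · exact (hmono t₀ ht₀ t ht h).symm
  subst hv hw
  exact hconst.trans (h₀ _ _ _)

end SymplecticFlows

/-! ### The symplectic volume -/

section Volume

variable {n : ℕ} {M : Type*} [TopologicalSpace M] [ChartedSpace (Model n) M]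

/-- An alternating 2-form on `E` as a bilinear form. -/
def bilinOfForm {E : Type*} [NormedAddCommGroup E] [NormedSpace ℝ E] (σ : E [⋀^Fin 2]→L[ℝ] ℝ) :
    LinearMap.BilinForm ℝ E :=
  have h0 : ∀ u v w : E, Function.update ![u, v] 0 w = ![w, v] := fun u v w => by
    ext i; fin_cases i <;> rfl
  have h1 : ∀ u v w : E, Function.update ![u, v] 1 w = ![u, w] := fun u v w => by
    ext i; fin_cases i <;> rfl
  LinearMap.mk₂ ℝ (fun u v => σ ![u, v])
    (fun u u' v => by simpa only [h0] using σ.map_update_add ![u, v] 0 u u')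
    (fun c u v => by simpa only [h0] using σ.map_update_smul ![u, v] 0 c u)
    (fun u v v' => by simpa only [h1] using σ.map_update_add ![u, v] 1 v v')
    (fun c u v => by simpa only [h1] using σ.map_update_smul ![u, v] 1 c v)

theorem gramMatrix_eq_toMatrix (Ω : SymplecticForm n M) (x₀ : M) (y : Model n) :
    gramMatrix Ω x₀ y = LinearMap.BilinForm.toMatrix
      (EuclideanSpace.basisFun (Fin (2 * n)) ℝ).toBasis (bilinOfForm (chartForm Ω.form x₀ y)) := by
  ext i j
  simp [gramMatrix, LinearMap.BilinForm.toMatrix_apply, bilinOfForm]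

/-- If a linear map pulls back one coordinate form to another, the Gram determinants differ by the
square of its determinant. -/
theorem det_gramMatrix_of_pullback (Ω : SymplecticForm n M) (x₀ y₀ : M) (y z : Model n)
    (L : Model n →L[ℝ] Model n)
    (h : ∀ u v, chartForm Ω.form x₀ z ![u, v] = chartForm Ω.form y₀ y ![L u, L v]) :
    (gramMatrix Ω x₀ z).det = L.det ^ 2 * (gramMatrix Ω y₀ y).det := by
  have hcomp : bilinOfForm (chartForm Ω.form x₀ z) =
      (bilinOfForm (chartForm Ω.form y₀ y)).comp L.toLinearMap L.toLinearMap := by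
    ext u v
    exact h u v
  rw [gramMatrix_eq_toMatrix, gramMatrix_eq_toMatrix, hcomp,
    LinearMap.BilinForm.toMatrix_comp (EuclideanSpace.basisFun (Fin (2 * n)) ℝ).toBasis
      (EuclideanSpace.basisFun (Fin (2 * n)) ℝ).toBasis,
    Matrix.det_mul, Matrix.det_mul, Matrix.det_transpose, LinearMap.det_toMatrix]
  show _ = LinearMap.det L.toLinearMap ^ 2 * _
  ring

theorem isSymplecticMap_refl (Ω : SymplecticForm n M) :
    IsSymplecticMap Ω (Diffeomorph.refl (𝓡 (2 * n)) M ∞) := by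
  intro x v w
  have h : ∀ u : TangentSpace (𝓡 (2 * n)) x,
      mfderiv (𝓡 (2 * n)) (𝓡 (2 * n)) (Diffeomorph.refl (𝓡 (2 * n)) M ∞) x u = u := fun u =>
    congrArg (fun L : TangentSpace (𝓡 (2 * n)) x →L[ℝ] TangentSpace (𝓡 (2 * n)) x => L u)
      (mfderiv_id (I := 𝓡 (2 * n)) (x := x))
  exact congrArg₂ (fun a b : TangentSpace (𝓡 (2 * n)) x => Ω.form x ![a, b]) (h v) (h w)

variable [MeasurableSpace M] [BorelSpace M]

theorem measurableSet_target_inter_preimage (x₀ : M) {B : Set M} (hB : MeasurableSet B) :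
    MeasurableSet ((extChartAt (𝓡 (2 * n)) x₀).target ∩
      (extChartAt (𝓡 (2 * n)) x₀).symm ⁻¹' B) := by
  have h := (continuousOn_iff_continuous_domRestrict.1
    (continuousOn_extChartAt_symm (I := 𝓡 (2 * n)) x₀)).measurable hB
  have h' := (isOpen_extChartAt_target (I := 𝓡 (2 * n)) x₀).measurableSet.subtype_image h
  convert h' using 1
  ext z
  simp [and_comm]

/-- The chart measure of a Borel set, computed in coordinates. -/
theorem chartVolume_apply (Ω : SymplecticForm n M) (x₀ : M) {B : Set M} (hB : MeasurableSet B) :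
    chartVolume Ω x₀ B =
      ∫⁻ y in (extChartAt (𝓡 (2 * n)) x₀).target ∩ (extChartAt (𝓡 (2 * n)) x₀).symm ⁻¹' B,
        ENNReal.ofReal √(gramMatrix Ω x₀ y).det := by
  have hm : AEMeasurable (extChartAt (𝓡 (2 * n)) x₀).symm
      (((volume : Measure (Model n)).restrict (extChartAt (𝓡 (2 * n)) x₀).target).withDensity
        fun y => ENNReal.ofReal √(gramMatrix Ω x₀ y).det) :=
    ((continuousOn_extChartAt_symm x₀).aemeasurable
      (isOpen_extChartAt_target x₀).measurableSet).mono_ac (withDensity_absolutelyContinuous _ _)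
  rw [chartVolume, Measure.map_apply_of_aemeasurable hm hB, withDensity_apply',
    Measure.restrict_restrict' (isOpen_extChartAt_target x₀).measurableSet, inter_comm]

variable [IsManifold (𝓡 (2 * n)) ∞ M]

/-- Change of variables: the expression `T` of a symplectic map in charts satisfies
`√det(Gram) = |det T'| √det(Gram ∘ T)`. -/
theorem chartVolume_preimage_le (Ω : SymplecticForm n M) {φ : Diff n M} (hφ : IsSymplecticMap Ω φ)
    (x₀ y₀ : M) {B : Set M} (hB : MeasurableSet B)
    (hBs : B ⊆ (extChartAt (𝓡 (2 * n)) y₀).source) :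
    chartVolume Ω x₀ (φ ⁻¹' B) ≤ chartVolume Ω y₀ B := by
  set ψ := extChartAt (𝓡 (2 * n)) x₀ with hψ
  set χ := extChartAt (𝓡 (2 * n)) y₀ with hχ
  have hφB : MeasurableSet (φ ⁻¹' B) := φ.continuous.measurable hB
  rw [chartVolume_apply Ω x₀ hφB, chartVolume_apply Ω y₀ hB]
  set s := ψ.target ∩ ψ.symm ⁻¹' (φ ⁻¹' B) with hs
  have hsm : MeasurableSet s := measurableSet_target_inter_preimage x₀ hφB
  set T : Model n → Model n := fun z => χ (φ (ψ.symm z)) with hT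
  have hd : ∀ z ∈ s, HasFDerivWithinAt T (fderiv ℝ T z) s z := fun z hz =>
    (hasFDerivAt_chart_expression φ.contMDiff x₀ y₀ hz.1
      (hBs hz.2)).differentiableAt.hasFDerivAt.hasFDerivWithinAt
  have hinj : InjOn T s := by
    intro z hz z' hz' h
    exact ψ.symm.injOn hz.1 hz'.1 (φ.injective (χ.injOn (hBs hz.2) (hBs hz'.2) h))
  have himg : T '' s ⊆ χ.target ∩ χ.symm ⁻¹' B := by
    rintro _ ⟨z, hz, rfl⟩
    refine ⟨χ.map_source (hBs hz.2), ?_⟩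
    simp only [hT, mem_preimage]
    rw [χ.left_inv (hBs hz.2)]
    exact hz.2
  refine le_trans (le_of_eq ?_) (lintegral_mono_set himg)
  rw [lintegral_image_eq_lintegral_abs_det_fderiv_mul volume hsm hd hinj]
  refine setLIntegral_congr_fun hsm fun z hz => ?_
  have hpull : ∀ u v, chartForm Ω.form x₀ z ![u, v] =
      chartForm Ω.form y₀ (T z) ![fderiv ℝ T z u, fderiv ℝ T z v] := by
    intro u v
    have hE := hasFDerivAt_chart_expression φ.contMDiff x₀ y₀ hz.1 (hBs hz.2)
    have hd : HasFDerivAt T (fderiv ℝ T z) z := hE.differentiableAt.hasFDerivAt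
    have hTu : ∀ u : Model n, fderiv ℝ T z u = mfderiv (𝓡 (2 * n)) 𝓘(ℝ, Model n) χ (φ (ψ.symm z))
        (mfderiv (𝓡 (2 * n)) (𝓡 (2 * n)) φ (ψ.symm z)
          (mfderiv 𝓘(ℝ, Model n) (𝓡 (2 * n)) ψ.symm z u)) := fun u =>
      DFunLike.congr_fun (hd.unique hE) u
    rw [hTu, hTu]
    refine (chartForm_apply Ω x₀ z u v).trans ?_
    refine (hφ (ψ.symm z) _ _).symm.trans ?_
    exact (chartForm_extChartAt Ω y₀ (hBs hz.2) _ _).symm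
  show ENNReal.ofReal _ = _
  rw [det_gramMatrix_of_pullback Ω x₀ y₀ (T z) z _ hpull, ← ENNReal.ofReal_mul (abs_nonneg _),
    Real.sqrt_mul (sq_nonneg _), Real.sqrt_sq_eq_abs]

/-- The volume is a supremum of measures, which is not the setwise supremum. The inequality is
obtained by bounding every chart measure by the transported volume, cutting `M` into countably many
disjoint pieces of chart domains. -/
theorem symplecticVolume_preimage_le [SecondCountableTopology M] [Nonempty M]
    (Ω : SymplecticForm n M) {φ : Diff n M} (hφ : IsSymplecticMap Ω φ) {B : Set M}
    (hB : MeasurableSet B) : symplecticVolume Ω (φ ⁻¹' B) ≤ symplecticVolume Ω B := by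
  obtain ⟨s, hsc, hsU⟩ := TopologicalSpace.countable_cover_nhds
    (f := fun y : M => (extChartAt (𝓡 (2 * n)) y).source) fun y => extChartAt_source_mem_nhds y
  have hsne : s.Nonempty := by
    obtain ⟨x⟩ := ‹Nonempty M›
    have : x ∈ ⋃ y ∈ s, (extChartAt (𝓡 (2 * n)) y).source := hsU ▸ mem_univ x
    obtain ⟨y, hy, -⟩ := mem_iUnion₂.1 this
    exact ⟨y, hy⟩
  obtain ⟨y, rfl⟩ := hsc.exists_eq_range hsne
  set U : ℕ → Set M := fun k => (extChartAt (𝓡 (2 * n)) (y k)).source with hUdef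
  have hcover : ⋃ k, U k = univ := by simpa only [biUnion_range] using hsU
  have hU : ∀ k, MeasurableSet (disjointed U k) :=
    MeasurableSet.disjointed fun k => (isOpen_extChartAt_source (y k)).measurableSet
  have hmeas : Measurable φ := φ.continuous.measurable
  -- compare the volume with the transport of each chart measure, on disjoint pieces of charts
  have hchart : ∀ x₀ (B : Set M), MeasurableSet B →
      chartVolume Ω x₀ (φ ⁻¹' B) ≤ symplecticVolume Ω B := by
    intro x₀ B hB
    have hsplit : B = ⋃ k, B ∩ disjointed U k := by
      rw [← inter_iUnion, iUnion_disjointed, hcover, inter_univ]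
    have hdisj : Pairwise (Function.onFun Disjoint fun k => B ∩ disjointed U k) := fun i j hij =>
      (disjoint_disjointed U hij).mono inter_subset_right inter_subset_right
    calc chartVolume Ω x₀ (φ ⁻¹' B) ≤ ∑' k, chartVolume Ω x₀ (φ ⁻¹' (B ∩ disjointed U k)) := by
          conv_lhs => rw [hsplit, preimage_iUnion]
          exact measure_iUnion_le _
      _ ≤ ∑' k, symplecticVolume Ω (B ∩ disjointed U k) := ENNReal.tsum_le_tsum fun k =>
          (chartVolume_preimage_le Ω hφ x₀ (y k) (hB.inter (hU k))
            (inter_subset_right.trans (disjointed_subset U k))).trans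
            (le_iSup (chartVolume Ω) (y k) _)
      _ = symplecticVolume Ω B := by
          rw [← measure_iUnion hdisj fun k => hB.inter (hU k), ← hsplit]
  have hmap : symplecticVolume Ω ≤ (symplecticVolume Ω).map φ.symm := by
    refine iSup_le fun x₀ => Measure.le_iff.2 fun C hC => ?_
    have hC' := φ.symm.continuous.measurable hC
    rw [Measure.map_apply φ.symm.continuous.measurable hC]
    have := hchart x₀ (φ.symm ⁻¹' C) hC'
    rw [← preimage_comp] at this
    simpa [Function.comp_def] using this
  have := hmap (φ ⁻¹' B)
  rw [Measure.map_apply φ.symm.continuous.measurable (hmeas hB), ← preimage_comp] at this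
  simpa [Function.comp_def] using this

theorem measurePreserving_symplecticVolume [SecondCountableTopology M] [Nonempty M]
    (Ω : SymplecticForm n M) {φ : Diff n M} (hφ : IsSymplecticMap Ω φ)
    (hφ' : IsSymplecticMap Ω φ.symm) :
    MeasurePreserving φ (symplecticVolume Ω) (symplecticVolume Ω) := by
  refine ⟨φ.continuous.measurable, Measure.ext fun B hB => ?_⟩
  rw [Measure.map_apply φ.continuous.measurable hB]
  refine le_antisymm (symplecticVolume_preimage_le Ω hφ hB) ?_
  have := symplecticVolume_preimage_le Ω hφ' (φ.continuous.measurable hB)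
  rw [← preimage_comp] at this
  simpa [Function.comp_def] using this

/-- On a chart domain the volume is given by the chart measure: on overlaps the chart measures
agree, by the change of variables for the identity map. -/
theorem symplecticVolume_le_chartVolume (Ω : SymplecticForm n M) (x₀ : M) {B : Set M}
    (hBm : MeasurableSet B) (hB : B ⊆ (extChartAt (𝓡 (2 * n)) x₀).source) :
    symplecticVolume Ω B ≤ chartVolume Ω x₀ B := by
  set U := (extChartAt (𝓡 (2 * n)) x₀).source with hU
  have hUm : MeasurableSet U := (isOpen_extChartAt_source x₀).measurableSet
  have h : symplecticVolume Ω ≤ chartVolume Ω x₀ + (symplecticVolume Ω).restrict Uᶜ := by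
    refine iSup_le fun x => Measure.le_iff.2 fun C hC => ?_
    rw [← measure_inter_add_sdiff C hUm, Measure.add_apply, Measure.restrict_apply hC]
    refine add_le_add ?_ (le_iSup (chartVolume Ω) x _)
    refine (chartVolume_preimage_le Ω (isSymplecticMap_refl Ω) x x₀ (hC.inter hUm)
      inter_subset_right).trans (measure_mono inter_subset_left)
  have hB' : B ∩ Uᶜ = ∅ := by
    rw [← sdiff_eq]; exact sdiff_eq_bot_iff.2 hB
  calc symplecticVolume Ω B ≤ (chartVolume Ω x₀ + (symplecticVolume Ω).restrict Uᶜ) B := h B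
    _ = chartVolume Ω x₀ B := by
      rw [Measure.add_apply, Measure.restrict_apply hBm, hB']
      simp

theorem isLocallyFiniteMeasure_symplecticVolume (Ω : SymplecticForm n M) [T2Space M] :
    IsLocallyFiniteMeasure (symplecticVolume Ω) := by
  refine ⟨fun x₀ => ?_⟩
  set ψ := extChartAt (𝓡 (2 * n)) x₀ with hψ
  obtain ⟨C, hC, hCx, hCt⟩ := exists_compact_subset
    (isOpen_extChartAt_target (I := 𝓡 (2 * n)) x₀) (mem_extChartAt_target (I := 𝓡 (2 * n)) x₀)
  have hcomp : IsCompact (ψ.symm '' C) :=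
    hC.image_of_continuousOn ((continuousOn_extChartAt_symm x₀).mono hCt)
  have himg : ψ.target ∩ ψ.symm ⁻¹' (ψ.symm '' C) = C := by
    ext z
    constructor
    · rintro ⟨hz, w, hw, hwz⟩
      rwa [← ψ.symm.injOn (hCt hw) hz hwz]
    · exact fun hz => ⟨hCt hz, z, hz, rfl⟩
  refine ⟨ψ.symm '' C, ?_, ?_⟩
  · have h1 : ψ ⁻¹' C ∈ 𝓝 x₀ := (continuousAt_extChartAt x₀).preimage_mem_nhds
      (mem_interior_iff_mem_nhds.1 hCx)
    filter_upwards [h1, extChartAt_source_mem_nhds (I := 𝓡 (2 * n)) x₀] with x hx hx'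
    exact ⟨ψ x, hx, ψ.left_inv hx'⟩
  · refine (symplecticVolume_le_chartVolume Ω x₀ hcomp.isClosed.measurableSet ?_).trans_lt ?_
    · rintro _ ⟨z, hz, rfl⟩
      exact ψ.map_target (hCt hz)
    · rw [chartVolume_apply Ω x₀ hcomp.isClosed.measurableSet, himg]
      have hcont : ContinuousOn (fun y => (gramMatrix Ω x₀ y).det) C := by
        have hentry : ∀ i j, ContinuousOn (fun y => gramMatrix Ω x₀ y i j) C := fun i j => by
          have h := ((Ω.smooth x₀).mono hCt).continuousOn
          exact fun y hy => ((continuous_eval_const _).tendsto _).comp (h y hy)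
        have : ContinuousOn (fun y => gramMatrix Ω x₀ y) C :=
          continuousOn_pi.2 fun i => continuousOn_pi.2 fun j => hentry i j
        exact (continuous_id.matrix_det).comp_continuousOn this
      obtain ⟨b, hb⟩ := hC.exists_bound_of_continuousOn hcont.sqrt
      calc ∫⁻ y in C, ENNReal.ofReal √(gramMatrix Ω x₀ y).det
          ≤ ∫⁻ _ in C, ENNReal.ofReal b := setLIntegral_mono measurable_const fun y hy =>
            ENNReal.ofReal_le_ofReal ((le_abs_self _).trans (hb y hy))
        _ < ⊤ := by
          rw [setLIntegral_const]
          exact ENNReal.mul_lt_top ENNReal.ofReal_lt_top hC.measure_lt_top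

end Volume

/-! ### Composition and inversion of Hamiltonian isotopies -/

section Velocities

variable {n : ℕ} {M : Type*} [TopologicalSpace M] [ChartedSpace (Model n) M]

theorem form_congr (Ω : SymplecticForm n M) {y y' : M} (h : y' = y) (v w : Model n) :
    (show ℝ from Ω.form y' ![v, w]) = Ω.form y ![v, w] := by
  subst h; rfl

theorem comp_smulRight_prod_id {E F : Type*} [NormedAddCommGroup E] [NormedSpace ℝ E]
    [NormedAddCommGroup F] [NormedSpace ℝ F] (L : E × ℝ →L[ℝ] F) (η : E) :
    L.comp (((ContinuousLinearMap.id ℝ ℝ).smulRight η).prod (ContinuousLinearMap.id ℝ ℝ)) =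
      (ContinuousLinearMap.id ℝ ℝ).smulRight (L (η, 0) + L (0, 1)) := by
  ext
  simp [← map_add]

/-- The velocity at time `t` of `s ↦ a_s (c_s)`. -/
theorem hasMFDerivWithinAt_family_curve {J : Set ℝ} (hJ : UniqueDiffOn ℝ J) {a : ℝ → M → M}
    (ha : ContMDiffOn ((𝓡 (2 * n)).prod 𝓘(ℝ, ℝ)) (𝓡 (2 * n)) ∞
      (fun q : M × ℝ => a q.2 q.1) (univ ×ˢ J)) {t : ℝ} (ht : t ∈ J)
    (hat : ContMDiff (𝓡 (2 * n)) (𝓡 (2 * n)) ∞ (a t)) {c : ℝ → M}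
    {η : TangentSpace (𝓡 (2 * n)) (c t)} {ξ : TangentSpace (𝓡 (2 * n)) (a t (c t))}
    (hc : HasMFDerivWithinAt 𝓘(ℝ, ℝ) (𝓡 (2 * n)) c J t
      ((ContinuousLinearMap.id ℝ ℝ).smulRight η))
    (hξ : HasMFDerivWithinAt 𝓘(ℝ, ℝ) (𝓡 (2 * n)) (fun s => a s (c t)) J t
      ((ContinuousLinearMap.id ℝ ℝ).smulRight ξ)) :
    HasMFDerivWithinAt 𝓘(ℝ, ℝ) (𝓡 (2 * n)) (fun s => a s (c s)) J t
      ((ContinuousLinearMap.id ℝ ℝ).smulRight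
        (mfderiv (𝓡 (2 * n)) (𝓡 (2 * n)) (a t) (c t) η + ξ)) := by
  set Φ : M × ℝ → M := fun q => a q.2 q.1 with hΦ
  have hd : HasMFDerivWithinAt ((𝓡 (2 * n)).prod 𝓘(ℝ, ℝ)) (𝓡 (2 * n)) Φ (univ ×ˢ J) (c t, t)
      (mfderivWithin ((𝓡 (2 * n)).prod 𝓘(ℝ, ℝ)) (𝓡 (2 * n)) Φ (univ ×ˢ J) (c t, t)) :=
    ((ha (c t, t) ⟨mem_univ _, ht⟩).mdifferentiableWithinAt (by simp)).hasMFDerivWithinAt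
  set L := mfderivWithin ((𝓡 (2 * n)).prod 𝓘(ℝ, ℝ)) (𝓡 (2 * n)) Φ (univ ×ˢ J) (c t, t) with hL
  have hidJ : HasMFDerivWithinAt 𝓘(ℝ, ℝ) 𝓘(ℝ, ℝ) (fun s : ℝ => s) J t
      (ContinuousLinearMap.id ℝ ℝ) := (hasMFDerivAt_id t).hasMFDerivWithinAt
  have h1 := HasMFDerivWithinAt.comp (g := Φ) (f := fun s => (c s, s)) t hd (hc.prodMk hidJ)
    (fun s hs => ⟨mem_univ _, hs⟩)
  have h2 := HasMFDerivWithinAt.comp (g := Φ) (f := fun s => (c t, s)) t hd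
    ((hasMFDerivAt_const (c t) t).hasMFDerivWithinAt.prodMk hidJ)
    (fun s hs => ⟨mem_univ _, hs⟩)
  have h3 := HasMFDerivWithinAt.comp (g := Φ) (f := fun y => (y, t)) (s := univ) (c t) hd
    ((hasMFDerivAt_id (c t)).hasMFDerivWithinAt.prodMk
      (hasMFDerivAt_const t (c t)).hasMFDerivWithinAt)
    (fun s hs => ⟨mem_univ _, ht⟩)
  have h3' := hasMFDerivWithinAt_univ.1 h3
  have e2 := (hJ t ht).uniqueMDiffWithinAt.eq h2 hξ
  have e3 := hasMFDerivAt_unique h3' ((hat.mdifferentiable (by simp)) (c t)).hasMFDerivAt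
  have e2' : L (0, (1 : ℝ)) = ξ := (DFunLike.congr_fun e2 (1 : ℝ)).trans (one_smul ℝ ξ)
  have e3' : L (η, (0 : ℝ)) = mfderiv (𝓡 (2 * n)) (𝓡 (2 * n)) (a t) (c t) η :=
    DFunLike.congr_fun e3 η
  have e4 : L.comp (((ContinuousLinearMap.id ℝ ℝ).smulRight η).prod (ContinuousLinearMap.id ℝ ℝ)) =
      ((ContinuousLinearMap.id ℝ ℝ).smulRight
        (mfderiv (𝓡 (2 * n)) (𝓡 (2 * n)) (a t) (c t) η + ξ)) := by
    rw [← e3', ← e2']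
    exact comp_smulRight_prod_id (E := Model n) (F := Model n) L η
  exact e4 ▸ h1

theorem hasMFDerivAt_diffeo (φ : Diff n M) (x : M) :
    HasMFDerivAt (𝓡 (2 * n)) (𝓡 (2 * n)) φ x (mfderiv (𝓡 (2 * n)) (𝓡 (2 * n)) φ x) :=
  (φ.contMDiff.mdifferentiable (by simp) x).hasMFDerivAt

theorem mfderiv_symm_mfderiv_diffeo (φ : Diff n M) (x : M) (v : TangentSpace (𝓡 (2 * n)) x) :
    (show Model n from mfderiv (𝓡 (2 * n)) (𝓡 (2 * n)) φ.symm (φ x)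
      (mfderiv (𝓡 (2 * n)) (𝓡 (2 * n)) φ x v)) = v := by
  have h := (hasMFDerivAt_diffeo φ.symm (φ x)).comp x (hasMFDerivAt_diffeo φ x)
  have hid : (φ.symm ∘ φ : M → M) = id := funext fun y => φ.symm_apply_apply y
  have h' : HasMFDerivAt (𝓡 (2 * n)) (𝓡 (2 * n)) (φ.symm ∘ φ : M → M) x
      (ContinuousLinearMap.id ℝ (TangentSpace (𝓡 (2 * n)) x)) :=
    (hasMFDerivAt_id x).congr_of_eventuallyEq (Eventually.of_forall fun y => congrFun hid y)
  exact DFunLike.congr_fun (hasMFDerivAt_unique h h') v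

theorem mfderiv_diffeo_surjective (φ : Diff n M) (x : M) :
    Function.Surjective (mfderiv (𝓡 (2 * n)) (𝓡 (2 * n)) φ x) := by
  have hinj : Function.Injective (mfderiv (𝓡 (2 * n)) (𝓡 (2 * n)) φ x) := by
    intro v w hvw
    have h1 := mfderiv_symm_mfderiv_diffeo φ x v
    have h2 := mfderiv_symm_mfderiv_diffeo φ x w
    exact h1.symm.trans ((congrArg (fun u =>
      (show Model n from mfderiv (𝓡 (2 * n)) (𝓡 (2 * n)) φ.symm (φ x) u)) hvw).trans h2)
  have hfin : ∀ L : Model n →L[ℝ] Model n, Function.Injective L → Function.Surjective L :=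
    fun L hL => LinearMap.injective_iff_surjective (f := L.toLinearMap) |>.1 hL
  exact hfin _ hinj

theorem IsSymplecticMap.symm {Ω : SymplecticForm n M} {φ : Diff n M} (h : IsSymplecticMap Ω φ) :
    IsSymplecticMap Ω φ.symm := by
  intro y v w
  obtain ⟨x, rfl⟩ := φ.surjective y
  obtain ⟨v', rfl⟩ := mfderiv_diffeo_surjective φ x v
  obtain ⟨w', rfl⟩ := mfderiv_diffeo_surjective φ x w
  have h1 := mfderiv_symm_mfderiv_diffeo φ x v'
  have h2 := mfderiv_symm_mfderiv_diffeo φ x w'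
  refine Eq.trans ?_ (h x v' w').symm
  refine Eq.trans ?_ (form_congr Ω (φ.symm_apply_apply x) v' w')
  exact congrArg₂ (fun a b : Model n => (show ℝ from Ω.form (φ.symm (φ x)) ![a, b])) h1 h2

theorem form_add_left (Ω : SymplecticForm n M) (x : M) (u v w : TangentSpace (𝓡 (2 * n)) x) :
    Ω.form x ![u + v, w] = Ω.form x ![u, w] + Ω.form x ![v, w] :=
  (bilinOfForm (E := Model n) (Ω.form x)).add_left u v w

theorem form_smul_left (Ω : SymplecticForm n M) (x : M) (r : ℝ)
    (v w : TangentSpace (𝓡 (2 * n)) x) :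
    Ω.form x ![r • v, w] = r * Ω.form x ![v, w] :=
  (bilinOfForm (E := Model n) (Ω.form x)).smul_left r v w

/-- The flows of `A` and `B` compose to the flow of `A_t + B_t ∘ a_t⁻¹`. -/
theorem Generates.comp {Ω : SymplecticForm n M} {J : Set ℝ} (hJ : UniqueDiffOn ℝ J)
    {a b : ℝ → Diff n M} {A B : ℝ → M → ℝ}
    (ha : ContMDiffOn ((𝓡 (2 * n)).prod 𝓘(ℝ, ℝ)) (𝓡 (2 * n)) ∞
      (fun q : M × ℝ => a q.2 q.1) (univ ×ˢ J))
    (hsymp : ∀ t ∈ J, IsSymplecticMap Ω (a t))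
    (hA : ∀ t ∈ J, ContMDiff (𝓡 (2 * n)) 𝓘(ℝ, ℝ) ∞ (A t))
    (hB : ∀ t ∈ J, ContMDiff (𝓡 (2 * n)) 𝓘(ℝ, ℝ) ∞ (B t))
    (hgA : Generates Ω J A a) (hgB : Generates Ω J B b) :
    Generates Ω J (fun t x => A t x + B t ((a t).symm x)) (fun t => (b t).trans (a t)) := by
  intro t ht x
  obtain ⟨η, hη, hηd⟩ := hgB t ht x
  obtain ⟨ξ, hξ, hξd⟩ := hgA t ht (b t x)
  refine ⟨mfderiv (𝓡 (2 * n)) (𝓡 (2 * n)) (a t) (b t x) η + ξ, ?_,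
    hasMFDerivWithinAt_family_curve hJ (a := fun s => a s) ha ht (a t).contMDiff hηd hξd⟩
  set C : M → ℝ := fun y => B t ((a t).symm y) with hC
  have hCs : ContMDiff (𝓡 (2 * n)) 𝓘(ℝ, ℝ) ∞ C := (hB t ht).comp (a t).symm.contMDiff
  have hCd : HasMFDerivAt (𝓡 (2 * n)) 𝓘(ℝ, ℝ) C (a t (b t x)) _ :=
    (hCs.mdifferentiable (by simp) _).hasMFDerivAt
  have hAd : HasMFDerivAt (𝓡 (2 * n)) 𝓘(ℝ, ℝ) (A t) (a t (b t x)) _ :=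
    ((hA t ht).mdifferentiable (by simp) _).hasMFDerivAt
  have hsum := (hAd.add hCd).mfderiv
  have hCa : C ∘ a t = B t := by
    funext y
    simp [hC]
  have hBd : HasMFDerivAt (𝓡 (2 * n)) 𝓘(ℝ, ℝ) (B t) (b t x) _ :=
    hCa ▸ hCd.comp (b t x) (hasMFDerivAt_diffeo (a t) (b t x))
  have hBd' := hBd.mfderiv
  intro w
  obtain ⟨w', rfl⟩ := mfderiv_diffeo_surjective (a t) (b t x) w
  have e1 : mfderiv (𝓡 (2 * n)) 𝓘(ℝ, ℝ) (fun y => A t y + C y) (a t (b t x))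
      (mfderiv (𝓡 (2 * n)) (𝓡 (2 * n)) (a t) (b t x) w') =
      (show ℝ from mfderiv (𝓡 (2 * n)) 𝓘(ℝ, ℝ) (A t) (a t (b t x))
        (mfderiv (𝓡 (2 * n)) (𝓡 (2 * n)) (a t) (b t x) w')) +
      (show ℝ from mfderiv (𝓡 (2 * n)) 𝓘(ℝ, ℝ) (B t) (b t x) w') :=
    (DFunLike.congr_fun hsum _).trans (congrArg₂ (fun r s : ℝ => r + s) rfl
      (DFunLike.congr_fun hBd' w').symm)
  refine (form_add_left Ω _ _ _ _).trans ?_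
  refine Eq.trans ?_ (congrArg Neg.neg e1.symm)
  refine Eq.trans (congrArg₂ (fun r s : ℝ => r + s) ((hsymp t ht (b t x) η w').trans (hη w'))
    (hξ _)) ?_
  exact (neg_add_rev (G := ℝ) _ _).symm

/-- The inverse of the flow of `A` is the flow of `-A_t ∘ a_t`. -/
theorem Generates.symm {Ω : SymplecticForm n M} {J : Set ℝ} (hJ : UniqueDiffOn ℝ J)
    {a : ℝ → Diff n M} {A : ℝ → M → ℝ}
    (ha : ContMDiffOn ((𝓡 (2 * n)).prod 𝓘(ℝ, ℝ)) (𝓡 (2 * n)) ∞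
      (fun q : M × ℝ => a q.2 q.1) (univ ×ˢ J))
    (ha' : ContMDiffOn ((𝓡 (2 * n)).prod 𝓘(ℝ, ℝ)) (𝓡 (2 * n)) ∞
      (fun q : M × ℝ => (a q.2).symm q.1) (univ ×ˢ J))
    (hsymp : ∀ t ∈ J, IsSymplecticMap Ω (a t))
    (hA : ∀ t ∈ J, ContMDiff (𝓡 (2 * n)) 𝓘(ℝ, ℝ) ∞ (A t))
    (hgA : Generates Ω J A a) :
    Generates Ω J (fun t x => -A t (a t x)) (fun t => (a t).symm) := by
  intro t ht x
  set z := (a t).symm x with hz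
  have hd : ∃ η : TangentSpace (𝓡 (2 * n)) z,
      HasMFDerivWithinAt 𝓘(ℝ, ℝ) (𝓡 (2 * n)) (fun s => (a s).symm x) J t
        ((ContinuousLinearMap.id ℝ ℝ).smulRight η) := by
    have h1 : ContMDiffWithinAt 𝓘(ℝ, ℝ) (𝓡 (2 * n)) ∞ (fun s => (a s).symm x) J t :=
      (ha' (x, t) ⟨mem_univ _, ht⟩).comp (f := fun s : ℝ => (x, s)) t
        (contMDiffWithinAt_const.prodMk contMDiffWithinAt_id) (fun s hs => ⟨mem_univ _, hs⟩)
    have h2 := (h1.mdifferentiableWithinAt (by simp)).hasMFDerivWithinAt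
    refine ⟨mfderivWithin 𝓘(ℝ, ℝ) (𝓡 (2 * n)) (fun s => (a s).symm x) J t (1 : ℝ), ?_⟩
    have h3 : ∀ L : ℝ →L[ℝ] Model n, (ContinuousLinearMap.id ℝ ℝ).smulRight (L 1) = L := by
      intro L; ext; simp
    exact (h3 _).symm ▸ h2
  obtain ⟨η, hη⟩ := hd
  obtain ⟨ξ, hξ, hξd⟩ := hgA t ht z
  refine ⟨η, ?_, hη⟩
  have hconst := hasMFDerivWithinAt_family_curve hJ (a := fun s => a s) ha ht (a t).contMDiff hη hξd
  have hconst' : HasMFDerivWithinAt 𝓘(ℝ, ℝ) (𝓡 (2 * n)) (fun s => a s ((a s).symm x)) J t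
      (0 : ℝ →L[ℝ] Model n) := by
    refine (hasMFDerivWithinAt_const (I := 𝓘(ℝ, ℝ)) (I' := 𝓡 (2 * n)) x J t).congr_of_eventuallyEq
      (Eventually.of_forall fun s => ?_) ?_ <;> simp
  have hzero := (hJ t ht).uniqueMDiffWithinAt.eq hconst hconst'
  have hzero' : mfderiv (𝓡 (2 * n)) (𝓡 (2 * n)) (a t) z η + ξ = 0 :=
    (one_smul ℝ _).symm.trans (DFunLike.congr_fun hzero (1 : ℝ))
  have hAd : HasMFDerivAt (𝓡 (2 * n)) 𝓘(ℝ, ℝ) (A t) (a t z) _ :=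
    ((hA t ht).mdifferentiable (by simp) _).hasMFDerivAt
  have hcomp := (hAd.comp z (hasMFDerivAt_diffeo (a t) z)).neg.mfderiv
  intro w
  have e1 : mfderiv (𝓡 (2 * n)) 𝓘(ℝ, ℝ) (fun y => -A t (a t y)) z w =
      -(show ℝ from mfderiv (𝓡 (2 * n)) 𝓘(ℝ, ℝ) (A t) (a t z)
        (mfderiv (𝓡 (2 * n)) (𝓡 (2 * n)) (a t) z w)) := DFunLike.congr_fun hcomp w
  refine Eq.trans ?_ (congrArg Neg.neg e1.symm)
  have e2 := form_add_left Ω (a t z) (mfderiv (𝓡 (2 * n)) (𝓡 (2 * n)) (a t) z η) ξ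
    (mfderiv (𝓡 (2 * n)) (𝓡 (2 * n)) (a t) z w)
  have e3 : Ω.form (a t z) ![(0 : TangentSpace (𝓡 (2 * n)) (a t z)),
      mfderiv (𝓡 (2 * n)) (𝓡 (2 * n)) (a t) z w] = 0 :=
    (bilinOfForm (E := Model n) (Ω.form (a t z))).zero_left _
  have e4 := e2.symm.trans ((congrArg (fun u : TangentSpace (𝓡 (2 * n)) (a t z) =>
    Ω.form (a t z) ![u, mfderiv (𝓡 (2 * n)) (𝓡 (2 * n)) (a t) z w]) hzero').trans e3)
  have e5 := (hsymp t ht z η w).symm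
  have e6 := hξ (mfderiv (𝓡 (2 * n)) (𝓡 (2 * n)) (a t) z w)
  refine e5.trans ((eq_neg_of_add_eq_zero_left e4).trans ?_)
  exact congrArg Neg.neg e6

end Velocities

/-! ### Normalized Hamiltonians and paths of diffeomorphisms -/

section NormalizedFunctions

variable {n : ℕ} {M : Type*} [TopologicalSpace M] [ChartedSpace (Model n) M]
  [MeasurableSpace M]

theorem smul_mem_normalizedFunctions {Ω : SymplecticForm n M} {u : M → ℝ}
    (hu : u ∈ normalizedFunctions Ω) (r : ℝ) : (fun x => r * u x) ∈ normalizedFunctions Ω := by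
  refine ⟨contMDiff_const.mul hu.1, fun h => ?_, fun h => ?_⟩
  · rw [integral_const_mul, hu.2.1 h, mul_zero]
  · exact (hu.2.2 h).mul_left

variable [IsManifold (𝓡 (2 * n)) ∞ M] [BorelSpace M]

theorem comp_mem_normalizedFunctions [SecondCountableTopology M] [Nonempty M]
    {Ω : SymplecticForm n M} {u : M → ℝ} {φ : Diff n M}
    (hu : u ∈ normalizedFunctions Ω) (hφ : IsSymplecticMap Ω φ) :
    (fun x => u (φ x)) ∈ normalizedFunctions Ω := by
  refine ⟨hu.1.comp φ.contMDiff, fun h => ?_, fun h => ?_⟩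
  · rw [(measurePreserving_symplecticVolume Ω hφ hφ.symm).integral_comp
      φ.toHomeomorph.measurableEmbedding u, hu.2.1 h]
  · exact (hu.2.2 h).comp_homeomorph φ.toHomeomorph

variable [T2Space M]

theorem integrable_of_continuous_of_compactSpace [CompactSpace M] (Ω : SymplecticForm n M)
    {u : M → ℝ} (hu : Continuous u) : Integrable u (symplecticVolume Ω) := by
  have := isLocallyFiniteMeasure_symplecticVolume Ω
  exact hu.integrable_of_hasCompactSupport (HasCompactSupport.of_compactSpace u)

theorem add_mem_normalizedFunctions {Ω : SymplecticForm n M} {u v : M → ℝ}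
    (hu : u ∈ normalizedFunctions Ω) (hv : v ∈ normalizedFunctions Ω) :
    (fun x => u x + v x) ∈ normalizedFunctions Ω := by
  refine ⟨hu.1.add hv.1, fun h => ?_, fun h => ?_⟩
  · rw [integral_add (integrable_of_continuous_of_compactSpace Ω hu.1.continuous)
      (integrable_of_continuous_of_compactSpace Ω hv.1.continuous), hu.2.1 h, hv.2.1 h, add_zero]
  · exact (hu.2.2 h).add (hv.2.2 h)

end NormalizedFunctions

section DiffPaths

variable {n : ℕ} {M : Type*} [TopologicalSpace M] [ChartedSpace (Model n) M]

theorem IsDiffPath.mono {J J' : Set ℝ} {f : ℝ → Diff n M} (hf : IsDiffPath J f) (h : J' ⊆ J) :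
    IsDiffPath J' f :=
  ⟨hf.smooth.mono (prod_mono_right h), let ⟨K, hK, hK'⟩ := hf.support
    ⟨K, hK, fun t ht => hK' t (h ht)⟩⟩

theorem IsDiffPath.reparam {J J' : Set ℝ} {f : ℝ → Diff n M} (hf : IsDiffPath J f) {c : ℝ → ℝ}
    (hc : ContDiff ℝ ∞ c) (h : MapsTo c J' J) : IsDiffPath J' (fun t => f (c t)) := by
  refine ⟨?_, let ⟨K, hK, hK'⟩ := hf.support; ⟨K, hK, fun t ht => hK' _ (h ht)⟩⟩
  exact hf.smooth.comp (f := fun q : M × ℝ => (q.1, c q.2))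
      (contMDiff_fst.prodMk (hc.contMDiff.comp contMDiff_snd)).contMDiffOn
      fun q hq => ⟨mem_univ _, h hq.2⟩

theorem closure_support_trans_subset (φ ψ : Diff n M) :
    closure {x | φ.trans ψ x ≠ x} ⊆ closure {x | φ x ≠ x} ∪ closure {x | ψ x ≠ x} := by
  rw [← closure_union]
  refine closure_mono fun x hx => ?_
  by_contra h
  simp only [mem_union, mem_ofPred_eq, not_or, not_not] at h
  exact hx (by simp [h.1, h.2])

theorem support_symm (φ : Diff n M) : {x | φ.symm x ≠ x} = {x | φ x ≠ x} := by
  ext x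
  rw [mem_ofPred_eq, mem_ofPred_eq, not_iff_not]
  constructor <;> intro h
  · conv_lhs => rw [← h]
    simp
  · conv_lhs => rw [← h]
    simp

theorem contMDiffOn_trans_family {N : Type*} {E' H' : Type*} [NormedAddCommGroup E']
    [NormedSpace ℝ E'] [TopologicalSpace H'] {I' : ModelWithCorners ℝ E' H'} [TopologicalSpace N]
    [ChartedSpace H' N] {S : Set N} {a b : N → M → M}
    (ha : ContMDiffOn ((𝓡 (2 * n)).prod I') (𝓡 (2 * n)) ∞ (fun q : M × N => a q.2 q.1) (univ ×ˢ S))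
    (hb : ContMDiffOn ((𝓡 (2 * n)).prod I') (𝓡 (2 * n)) ∞ (fun q : M × N => b q.2 q.1)
      (univ ×ˢ S)) :
    ContMDiffOn ((𝓡 (2 * n)).prod I') (𝓡 (2 * n)) ∞ (fun q : M × N => a q.2 (b q.2 q.1))
      (univ ×ˢ S) :=
  ha.comp (f := fun q : M × N => (b q.2 q.1, q.2)) (hb.prodMk contMDiffOn_snd)
    fun _ hq => ⟨mem_univ _, hq.2⟩

theorem IsDiffPath.trans {J : Set ℝ} {f g : ℝ → Diff n M} (hf : IsDiffPath J f)
    (hg : IsDiffPath J g) : IsDiffPath J (fun t => (f t).trans (g t)) := by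
  refine ⟨contMDiffOn_trans_family (a := fun t => g t) (b := fun t => f t) hg.smooth hf.smooth, ?_⟩
  obtain ⟨K, hK, hK'⟩ := hf.support
  obtain ⟨L, hL, hL'⟩ := hg.support
  exact ⟨K ∪ L, hK.union hL, fun t ht => (closure_support_trans_subset _ _).trans
    (union_subset_union (hK' t ht) (hL' t ht))⟩

variable [T2Space M] [IsManifold (𝓡 (2 * n)) ∞ M]

theorem IsDiffPath.symm {J : Set ℝ} (hJ : UniqueDiffOn ℝ J) {f : ℝ → Diff n M}
    (hf : IsDiffPath J f) : IsDiffPath J (fun t => (f t).symm) := by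
  obtain ⟨K, hK, hK'⟩ := hf.support
  exact ⟨contMDiffOn_symm_family hJ hf.smooth hK hK',
    K, hK, fun t ht => by rw [support_symm]; exact hK' t ht⟩

end DiffPaths

section Hamiltonians

variable {n : ℕ} {M : Type*} [TopologicalSpace M] [ChartedSpace (Model n) M]
  [MeasurableSpace M]

theorem IsNormalizedHamiltonian.mono {Ω : SymplecticForm n M} {J J' : Set ℝ} {F : ℝ → M → ℝ}
    (hF : IsNormalizedHamiltonian Ω J F) (h : J' ⊆ J) : IsNormalizedHamiltonian Ω J' F :=
  ⟨hF.smooth.mono (prod_mono_right h), fun t ht => hF.normalized t (h ht), fun hM =>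
    let ⟨K, hK, hK'⟩ := hF.support hM
    ⟨K, hK, fun t ht => hK' t (h ht)⟩⟩

/-- Substituting the time and rescaling a normalized Hamiltonian. -/
theorem IsNormalizedHamiltonian.reparam {Ω : SymplecticForm n M} {J J' : Set ℝ} {F : ℝ → M → ℝ}
    (hF : IsNormalizedHamiltonian Ω J F) {c r : ℝ → ℝ} (hc : ContDiff ℝ ∞ c)
    (hr : ContDiff ℝ ∞ r) (h : MapsTo c J' J) :
    IsNormalizedHamiltonian Ω J' (fun t x => r t * F (c t) x) := by
  refine ⟨?_, fun t ht => smul_mem_normalizedFunctions (hF.normalized _ (h ht)) _, fun hM => ?_⟩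
  · refine ContMDiffOn.mul (hr.contMDiff.comp contMDiff_snd).contMDiffOn ?_
    exact hF.smooth.comp (f := fun q : M × ℝ => (q.1, c q.2))
      (contMDiff_fst.prodMk (hc.contMDiff.comp contMDiff_snd)).contMDiffOn
      fun q hq => ⟨mem_univ _, h hq.2⟩
  · obtain ⟨K, hK, hK'⟩ := hF.support hM
    refine ⟨K, hK, fun t ht => Subset.trans ?_ (hK' _ (h ht))⟩
    exact tsupport_mul_subset_right (f := fun _ : M => r t) (g := F (c t))

theorem IsNormalizedHamiltonian.neg {Ω : SymplecticForm n M} {J : Set ℝ} {F : ℝ → M → ℝ}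
    (hF : IsNormalizedHamiltonian Ω J F) : IsNormalizedHamiltonian Ω J (fun t x => -F t x) := by
  have := hF.reparam (c := fun t => t) (r := fun _ => -1) contDiff_id contDiff_const (mapsTo_id J)
  simpa using this

variable [T2Space M] [IsManifold (𝓡 (2 * n)) ∞ M] [BorelSpace M]

theorem IsNormalizedHamiltonian.add {Ω : SymplecticForm n M} {J : Set ℝ} {F G : ℝ → M → ℝ}
    (hF : IsNormalizedHamiltonian Ω J F) (hG : IsNormalizedHamiltonian Ω J G) :
    IsNormalizedHamiltonian Ω J (fun t x => F t x + G t x) := by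
  refine ⟨hF.smooth.add hG.smooth,
    fun t ht => add_mem_normalizedFunctions (hF.normalized t ht) (hG.normalized t ht), fun hM => ?_⟩
  obtain ⟨K, hK, hK'⟩ := hF.support hM
  obtain ⟨L, hL, hL'⟩ := hG.support hM
  exact ⟨K ∪ L, hK.union hL, fun t ht => (tsupport_add (F t) (G t)).trans
    (union_subset_union (hK' t ht) (hL' t ht))⟩

variable [SecondCountableTopology M] [Nonempty M]

theorem IsNormalizedHamiltonian.comp {Ω : SymplecticForm n M} {J : Set ℝ} {F : ℝ → M → ℝ}
    (hF : IsNormalizedHamiltonian Ω J F) {f : ℝ → Diff n M} (hf : IsDiffPath J f)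
    (hsymp : ∀ t ∈ J, IsSymplecticMap Ω (f t)) :
    IsNormalizedHamiltonian Ω J (fun t x => F t (f t x)) := by
  refine ⟨?_, fun t ht => comp_mem_normalizedFunctions (hF.normalized t ht) (hsymp t ht),
    fun hM => ?_⟩
  · exact hF.smooth.comp (f := fun q : M × ℝ => (f q.2 q.1, q.2))
      (hf.smooth.prodMk contMDiffOn_snd) fun _ hq => ⟨mem_univ _, hq.2⟩
  · obtain ⟨K, hK, hK'⟩ := hF.support hM
    obtain ⟨L, hL, hL'⟩ := hf.support
    refine ⟨K ∪ L, hK.union hL, fun t ht => closure_minimal (fun x hx => ?_)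
      (hK.union hL).isClosed⟩
    by_cases h : f t x = x
    · left
      refine hK' t ht (subset_tsupport _ ?_)
      simpa [h] using hx
    · exact Or.inr (hL' t ht (subset_closure h))

end Hamiltonians

/-! ### Normalized Hamiltonian flows and the Hamiltonian group -/

section Flows

variable {n : ℕ} {M : Type*} [TopologicalSpace M] [ChartedSpace (Model n) M]

theorem hasMFDerivAt_real_of_hasDerivAt {c : ℝ → ℝ} {c' t : ℝ} (h : HasDerivAt c c' t) :
    HasMFDerivAt 𝓘(ℝ, ℝ) 𝓘(ℝ, ℝ) c t ((ContinuousLinearMap.id ℝ ℝ).smulRight c') := by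
  refine HasFDerivAt.hasMFDerivAt ?_
  exact h.hasFDerivAt

theorem Generates.mono {Ω : SymplecticForm n M} {J J' : Set ℝ} {F : ℝ → M → ℝ} {f : ℝ → Diff n M}
    (hf : Generates Ω J F f) (h : J' ⊆ J) : Generates Ω J' F f := fun t ht x =>
  let ⟨ξ, hξ, hξd⟩ := hf t (h ht) x
  ⟨ξ, hξ, hξd.mono h⟩

theorem Generates.reparam {Ω : SymplecticForm n M} {J J' : Set ℝ} {F : ℝ → M → ℝ}
    {f : ℝ → Diff n M} (hf : Generates Ω J F f)
    (hF : ∀ t ∈ J, ContMDiff (𝓡 (2 * n)) 𝓘(ℝ, ℝ) ∞ (F t)) {c c' : ℝ → ℝ}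
    (hc : ∀ t ∈ J', HasDerivAt c (c' t) t) (h : MapsTo c J' J) :
    Generates Ω J' (fun t x => c' t * F (c t) x) (fun t => f (c t)) := by
  intro t ht x
  obtain ⟨ξ, hξ, hξd⟩ := hf (c t) (h ht) x
  refine ⟨c' t • ξ, fun w => ?_, ?_⟩
  · have hFd : HasMFDerivAt (𝓡 (2 * n)) 𝓘(ℝ, ℝ) (F (c t)) (f (c t) x) _ :=
      ((hF _ (h ht)).mdifferentiable (by simp) _).hasMFDerivAt
    have e1 : mfderiv (𝓡 (2 * n)) 𝓘(ℝ, ℝ) (fun y => c' t * F (c t) y) (f (c t) x) w =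
        c' t * (show ℝ from mfderiv (𝓡 (2 * n)) 𝓘(ℝ, ℝ) (F (c t)) (f (c t) x) w) :=
      DFunLike.congr_fun (hFd.const_smul (c' t)).mfderiv w
    refine (form_smul_left Ω _ _ _ _).trans ?_
    refine (congrArg (fun r => c' t * r) (hξ w)).trans ?_
    refine Eq.trans ?_ (congrArg Neg.neg e1.symm)
    exact mul_neg _ _
  · have h1 := HasMFDerivWithinAt.comp (g := fun s => f s x) (f := c) t hξd
      (hasMFDerivAt_real_of_hasDerivAt (hc t ht)).hasMFDerivWithinAt h
    have h2 : ∀ (v : Model n) (r : ℝ), ((ContinuousLinearMap.id ℝ ℝ).smulRight v).comp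
        ((ContinuousLinearMap.id ℝ ℝ).smulRight r) =
        (ContinuousLinearMap.id ℝ ℝ).smulRight (r • v) := fun v r => by ext; simp
    exact h2 ξ (c' t) ▸ h1

theorem Generates.precomp {Ω : SymplecticForm n M} {J : Set ℝ} {F : ℝ → M → ℝ} {f : ℝ → Diff n M}
    (hf : Generates Ω J F f) (φ : Diff n M) : Generates Ω J F (fun t => φ.trans (f t)) :=
  fun t ht x => hf t ht (φ x)

theorem IsDiffPath.precomp {J : Set ℝ} {f : ℝ → Diff n M} (hf : IsDiffPath J f) {φ : Diff n M}
    {K : Set M} (hK : IsCompact K) (hφ : closure {x | φ x ≠ x} ⊆ K) :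
    IsDiffPath J (fun t => φ.trans (f t)) :=
  IsDiffPath.trans (f := fun _ => φ)
    ⟨(φ.contMDiff.comp contMDiff_fst).contMDiffOn, K, hK, fun _ _ => hφ⟩ hf

/-- A curve whose velocity vanishes identically is constant. -/
theorem eq_of_hasMFDerivAt_zero [IsManifold (𝓡 (2 * n)) ∞ M] {c : ℝ → M}
    (hc : ∀ t, HasMFDerivAt 𝓘(ℝ, ℝ) (𝓡 (2 * n)) c t (0 : ℝ →L[ℝ] Model n)) (s t : ℝ) :
    c s = c t := by
  refine IsLocallyConstant.apply_eq_of_preconnectedSpace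
    ((IsLocallyConstant.iff_eventually_eq c).2 fun t₀ => ?_) s t
  set χ := extChartAt (𝓡 (2 * n)) (c t₀) with hχ
  have hcont : Continuous c := continuous_iff_continuousAt.2 fun t => (hc t).continuousAt
  obtain ⟨ε, hε, hball⟩ := Metric.isOpen_iff.1
    ((isOpen_extChartAt_source (I := 𝓡 (2 * n)) (c t₀)).preimage hcont) t₀
    (mem_extChartAt_source (c t₀))
  have hd : ∀ t ∈ Metric.ball t₀ ε, HasFDerivAt (fun s => χ (c s)) (0 : ℝ →L[ℝ] Model n) t := by
    intro t ht
    have h := ((hasMFDerivAt_extChartAt (c t₀) (hball ht)).comp t (hc t)).hasFDerivAt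
    have h0 : ∀ L : Model n →L[ℝ] Model n, L.comp (0 : ℝ →L[ℝ] Model n) = 0 := fun L => by simp
    exact h0 (mfderiv (𝓡 (2 * n)) 𝓘(ℝ, Model n) χ (c t)) ▸ h
  filter_upwards [Metric.ball_mem_nhds t₀ hε] with t ht
  have := (convex_ball t₀ ε).is_const_of_fderivWithin_eq_zero (𝕜 := ℝ) (f := fun s => χ (c s))
    (fun t ht => (hd t ht).differentiableAt.differentiableWithinAt)
    (fun t ht => by
      rw [fderivWithin_of_isOpen Metric.isOpen_ball ht, (hd t ht).fderiv])
    ht (Metric.mem_ball_self hε)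
  exact χ.injOn (hball ht) (mem_extChartAt_source (c t₀)) this

/-- Intervals of times containing the initial time `0`. -/
structure IsTimeInterval (J : Set ℝ) : Prop where
  uniqueDiffOn : UniqueDiffOn ℝ J
  ordConnected : J.OrdConnected
  zero_mem : (0 : ℝ) ∈ J

theorem isTimeInterval_univ : IsTimeInterval univ :=
  ⟨uniqueDiffOn_univ, ordConnected_univ, mem_univ _⟩

theorem isTimeInterval_Icc : IsTimeInterval (Icc 0 1) :=
  ⟨uniqueDiffOn_Icc_zero_one, ordConnected_Icc, by simp⟩

variable [MeasurableSpace M]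

/-- `f` is the Hamiltonian flow of the normalized Hamiltonian `F` over the time interval `J`. -/
structure IsNormalizedFlow (Ω : SymplecticForm n M) (J : Set ℝ) (F : ℝ → M → ℝ)
    (f : ℝ → Diff n M) : Prop where
  ham : IsNormalizedHamiltonian Ω J F
  flow : IsHamiltonianFlow Ω J F f

namespace IsNormalizedFlow

variable {Ω : SymplecticForm n M} {J J' : Set ℝ} {F G : ℝ → M → ℝ} {f g : ℝ → Diff n M}

theorem mono (hf : IsNormalizedFlow Ω J F f) (h : J' ⊆ J) : IsNormalizedFlow Ω J' F f :=
  ⟨hf.ham.mono h, hf.flow.path.mono h, hf.flow.zero, hf.flow.generates.mono h⟩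

theorem reparam (hf : IsNormalizedFlow Ω J F f) {c c' : ℝ → ℝ} (hc : ContDiff ℝ ∞ c)
    (hc' : ContDiff ℝ ∞ c') (hcd : ∀ t, HasDerivAt c (c' t) t) (h : MapsTo c J' J) (h0 : c 0 = 0) :
    IsNormalizedFlow Ω J' (fun t x => c' t * F (c t) x) (fun t => f (c t)) :=
  ⟨hf.ham.reparam hc hc' h, hf.flow.path.reparam hc h, by simp only [h0]; exact hf.flow.zero,
    hf.flow.generates.reparam (fun t ht => (hf.ham.normalized t ht).1) (fun t _ => hcd t) h⟩

theorem mem_Ham (hf : IsNormalizedFlow Ω (Icc 0 1) F f) {t : ℝ} (ht : t ∈ Icc (0 : ℝ) 1) :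
    f t ∈ Ham Ω := by
  have h := hf.reparam (J' := Icc 0 1) (c := fun s => t * s) (c' := fun _ => t) (by fun_prop)
    contDiff_const (fun s => by simpa using (hasDerivAt_id s).const_mul t)
    (fun s hs => ⟨mul_nonneg ht.1 hs.1, mul_le_one₀ ht.2 hs.1 hs.2⟩) (by simp)
  exact ⟨_, _, h.ham, h.flow, by simp⟩

variable [IsManifold (𝓡 (2 * n)) ∞ M]

theorem isSymplecticMap (hJ : IsTimeInterval J) (hf : IsNormalizedFlow Ω J F f) {t : ℝ}
    (ht : t ∈ J) : IsSymplecticMap Ω (f t) :=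
  isSymplecticMap_of_generates Ω hJ.uniqueDiffOn hJ.ordConnected hf.flow.path.smooth hf.ham.smooth
    hf.flow.generates hJ.zero_mem (by rw [hf.flow.zero]; exact isSymplecticMap_refl Ω) ht

variable [T2Space M] [BorelSpace M] [SecondCountableTopology M] [Nonempty M]

theorem symm (hJ : IsTimeInterval J) (hf : IsNormalizedFlow Ω J F f) :
    IsNormalizedFlow Ω J (fun t x => -F t (f t x)) (fun t => (f t).symm) :=
  ⟨(hf.ham.comp hf.flow.path fun _ ht => hf.isSymplecticMap hJ ht).neg,
    hf.flow.path.symm hJ.uniqueDiffOn, by simp only [hf.flow.zero]; rfl,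
    hf.flow.generates.symm hJ.uniqueDiffOn hf.flow.path.smooth
      (hf.flow.path.symm hJ.uniqueDiffOn).smooth (fun _ ht => hf.isSymplecticMap hJ ht)
      fun t ht => (hf.ham.normalized t ht).1⟩

theorem trans (hJ : IsTimeInterval J) (hf : IsNormalizedFlow Ω J F f)
    (hg : IsNormalizedFlow Ω J G g) :
    IsNormalizedFlow Ω J (fun t x => F t x + G t ((f t).symm x)) (fun t => (g t).trans (f t)) :=
  ⟨hf.ham.add (hg.ham.comp (hf.flow.path.symm hJ.uniqueDiffOn)
      fun _ ht => (hf.isSymplecticMap hJ ht).symm),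
    hg.flow.path.trans hf.flow.path, by simp only [hf.flow.zero, hg.flow.zero]; rfl,
    hf.flow.generates.comp hJ.uniqueDiffOn hf.flow.path.smooth
      (fun _ ht => hf.isSymplecticMap hJ ht) (fun t ht => (hf.ham.normalized t ht).1)
      (fun t ht => (hg.ham.normalized t ht).1) hg.flow.generates⟩

/-- A normalized Hamiltonian on `M × ℝ` has at most one flow: if `f` and `g` are flows of `F`, then
`f_t⁻¹ ∘ g_t` is generated by the zero Hamiltonian. -/
theorem unique (hf : IsNormalizedFlow Ω univ F f) (hg : IsNormalizedFlow Ω univ F g) : f = g := by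
  have h := (hf.symm isTimeInterval_univ).trans isTimeInterval_univ hg
  have key : ∀ x t, (f t).symm (g t x) = x := by
    intro x t
    have hc : ∀ t, HasMFDerivAt 𝓘(ℝ, ℝ) (𝓡 (2 * n)) (fun s => (f s).symm (g s x)) t
        (0 : ℝ →L[ℝ] Model n) := by
      intro t
      obtain ⟨ξ, hξ, hξd⟩ := h.flow.generates t (mem_univ t) x
      have hzero : (fun y => -F t (f t y) + F t ((f t).symm.symm y)) = fun _ : M => (0 : ℝ) := by
        funext y
        show -F t (f t y) + F t (f t y) = 0
        ring
      have hξ0 : ξ = 0 := by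
        by_contra hne
        obtain ⟨w, hw⟩ := Ω.nondegenerate _ ξ hne
        refine hw ((hξ w).trans ?_)
        have hd : mfderiv (𝓡 (2 * n)) 𝓘(ℝ, ℝ)
            (fun y => -F t (f t y) + F t ((f t).symm.symm y)) ((f t).symm (g t x)) = 0 := by
          rw [hzero]; exact mfderiv_const
        exact (congrArg Neg.neg (DFunLike.congr_fun hd w)).trans neg_zero
      have := hasMFDerivWithinAt_univ.1 hξd
      rw [hξ0] at this
      have h2 : (ContinuousLinearMap.id ℝ ℝ).smulRight (0 : Model n) = 0 := by ext; simp
      exact h2 ▸ this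
    have := eq_of_hasMFDerivAt_zero hc t 0
    rw [this, hf.flow.zero, hg.flow.zero]
    rfl
  funext t
  ext x
  have := congrArg (f t) (key x t)
  simpa using this.symm

/-- The flow of a `T`-periodic Hamiltonian satisfies `f_{t+T} = f_t ∘ f_T`. -/
theorem add_period (hf : IsNormalizedFlow Ω univ F f) {T : ℝ}
    (hper : ∀ t x, F (t + T) x = F t x) (t : ℝ) : f (t + T) = (f T).trans (f t) := by
  obtain ⟨K, hK, hK'⟩ := hf.flow.path.support
  have hF : (fun t x => (1 : ℝ) * F (t + T) x) = F := by
    funext t x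
    rw [one_mul, hper]
  have hd : ∀ t : ℝ, HasDerivAt (fun s : ℝ => s + T) 1 t := fun t => (hasDerivAt_id t).add_const T
  have hg : IsNormalizedFlow Ω univ F (fun t => (f T).symm.trans (f (t + T))) := by
    refine ⟨hf.ham, ?_, ?_, ?_⟩
    · refine (hf.flow.path.reparam (J' := univ) (c := fun t => t + T) (by fun_prop)
        (mapsTo_univ _ _)).precomp hK ?_
      rw [support_symm]
      exact hK' T (mem_univ _)
    · simp only [zero_add]
      exact Diffeomorph.symm_trans_self (f T)
    · have := (hf.flow.generates.reparam (J' := univ) (fun t ht => (hf.ham.normalized t ht).1)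
        (fun t _ => hd t) (mapsTo_univ _ _)).precomp (f T).symm
      rwa [hF] at this
  have h := congrFun (hf.unique hg) t
  rw [h]
  ext x
  simp

end IsNormalizedFlow

end Flows

section HamGroup

variable {n : ℕ} {M : Type*} [TopologicalSpace M] [ChartedSpace (Model n) M]
  [MeasurableSpace M] [IsManifold (𝓡 (2 * n)) ∞ M] [T2Space M] [BorelSpace M]
  [SecondCountableTopology M] [Nonempty M] {Ω : SymplecticForm n M} {φ ψ : Diff n M}

theorem symm_mem_Ham (hφ : φ ∈ Ham Ω) : φ.symm ∈ Ham Ω := by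
  obtain ⟨F, f, hF, hf, rfl⟩ := hφ
  have h := IsNormalizedFlow.symm isTimeInterval_Icc ⟨hF, hf⟩
  exact ⟨_, _, h.ham, h.flow, rfl⟩

theorem trans_mem_Ham (hφ : φ ∈ Ham Ω) (hψ : ψ ∈ Ham Ω) : φ.trans ψ ∈ Ham Ω := by
  obtain ⟨F, f, hF, hf, rfl⟩ := hφ
  obtain ⟨G, g, hG, hg, rfl⟩ := hψ
  have h := IsNormalizedFlow.trans isTimeInterval_Icc ⟨hG, hg⟩ ⟨hF, hf⟩
  exact ⟨_, _, h.ham, h.flow, rfl⟩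

end HamGroup

/-! ### Oscillation and reparametrization by arc length -/

section Oscillation

theorem osc_comp {M : Type*} (u : M → ℝ) {φ : M → M} (hφ : φ.Surjective) :
    osc (fun x => u (φ x)) = osc u := by
  unfold osc
  rw [hφ.iSup_comp u, hφ.iInf_comp u]

theorem osc_const_mul {M : Type*} (u : M → ℝ) {r : ℝ} (hr : 0 ≤ r) :
    osc (fun x => r * u x) = r * osc u := by
  unfold osc
  rw [← Real.mul_iSup_of_nonneg hr, ← Real.mul_iInf_of_nonneg hr, mul_sub]

variable {n : ℕ} {M : Type*} [TopologicalSpace M] [ChartedSpace (Model n) M]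
  [MeasurableSpace M] {Ω : SymplecticForm n M} {J : Set ℝ} {F : ℝ → M → ℝ}

/-- All values of a normalized Hamiltonian are attained on a compact set: on `M` if `M` is compact,
and otherwise on the union of the common support with one point outside of it. -/
theorem IsNormalizedHamiltonian.exists_compact_image_eq_range
    (hF : IsNormalizedHamiltonian Ω J F) :
    ∃ K : Set M, IsCompact K ∧ ∀ t ∈ J, F t '' K = range (F t) := by
  by_cases hM : CompactSpace M
  · exact ⟨univ, isCompact_univ, fun t _ => image_univ⟩
  · rw [not_compactSpace_iff] at hM
    obtain ⟨K, hK, hK'⟩ := hF.support hM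
    obtain ⟨x₀, hx₀⟩ := (ne_univ_iff_exists_notMem K).1 hK.ne_univ
    have h0 : ∀ t ∈ J, ∀ x ∉ K, F t x = 0 := fun t ht x hx =>
      image_eq_zero_of_notMem_tsupport fun h => hx (hK' t ht h)
    refine ⟨insert x₀ K, hK.insert x₀, fun t ht => (image_subset_range _ _).antisymm ?_⟩
    rintro _ ⟨x, rfl⟩
    by_cases hx : x ∈ K
    · exact mem_image_of_mem _ (mem_insert_of_mem _ hx)
    · exact ⟨x₀, mem_insert _ _, by rw [h0 t ht x hx, h0 t ht x₀ hx₀]⟩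

theorem IsNormalizedHamiltonian.continuousOn_osc (hF : IsNormalizedHamiltonian Ω J F) :
    ContinuousOn (fun t => osc (F t)) J := by
  obtain ⟨K, hK, hK'⟩ := hF.exists_compact_image_eq_range
  rw [continuousOn_iff_continuous_domRestrict]
  have hcont : Continuous (Function.uncurry fun (t : J) (x : M) => F t x) := by
    have h := continuousOn_iff_continuous_domRestrict.1 hF.smooth.continuousOn
    exact h.comp (g := (univ ×ˢ J).domRestrict fun p : M × ℝ => F p.2 p.1)
      (f := fun q : J × M => ⟨(q.2, (q.1 : ℝ)), mem_univ _, q.1.2⟩) (by fun_prop)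
  have h := (IsCompact.continuous_sSup (f := fun (t : J) (x : M) => F t x) hK hcont).sub
    (IsCompact.continuous_sInf (f := fun (t : J) (x : M) => F t x) hK hcont)
  refine h.congr fun t => ?_
  show sSup (F t '' K) - sInf (F t '' K) = sSup (range (F t)) - sInf (range (F t))
  rw [hK' t t.2]

theorem bddAbove_range_osc (hF : IsNormalizedHamiltonian Ω univ F)
    (hper : ∀ t x, F (t + 1) x = F t x) : BddAbove (range fun t => osc (F t)) := by
  have hp : Function.Periodic (fun t => osc (F t)) 1 := fun t => congrArg osc (funext (hper t))
  exact (hp.compact_of_continuous one_ne_zero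
    (continuousOn_univ.1 hF.continuousOn_osc)).bddAbove

variable [Nonempty M]

theorem IsNormalizedHamiltonian.osc_nonneg (hF : IsNormalizedHamiltonian Ω J F) {t : ℝ}
    (ht : t ∈ J) : 0 ≤ osc (F t) := by
  obtain ⟨K, hK, hK'⟩ := hF.exists_compact_image_eq_range
  have hc : IsCompact (range (F t)) := hK' t ht ▸ hK.image (hF.normalized t ht).1.continuous
  exact sub_nonneg.2 (ciInf_le_ciSup hc.bddBelow hc.bddAbove)

theorem integral_osc_nonneg (hF : IsNormalizedHamiltonian Ω (Icc 0 1) F) :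
    0 ≤ ∫ t in (0 : ℝ)..1, osc (F t) :=
  intervalIntegral.integral_nonneg zero_le_one fun _ ht => hF.osc_nonneg ht

end Oscillation

section Reparametrization

theorem hasDerivAt_integral_of_contDiff {m : ℝ → ℝ} (hm : ContDiff ℝ ∞ m) (t : ℝ) :
    HasDerivAt (fun s => ∫ u in (0 : ℝ)..s, m u) (m t) t :=
  intervalIntegral.integral_hasDerivAt_right (hm.continuous.intervalIntegrable _ _)
    (hm.continuous.stronglyMeasurableAtFilter _ _) hm.continuous.continuousAt

theorem contDiff_of_hasDerivAt {c c' : ℝ → ℝ} (h : ∀ t, HasDerivAt c (c' t) t)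
    (hc' : ContDiff ℝ ∞ c') : ContDiff ℝ ∞ c := by
  rw [contDiff_infty_iff_deriv]
  refine ⟨fun t => (h t).differentiableAt, ?_⟩
  rwa [show deriv c = c' from funext fun t => (h t).deriv]

/-- A continuous function on `[0, 1]` is approximated from above by positive smooth functions on
`ℝ`. -/
theorem exists_contDiff_ge_integral_le {φ : ℝ → ℝ} (hφ : ContinuousOn φ (Icc 0 1))
    (h0 : ∀ s ∈ Icc (0 : ℝ) 1, 0 ≤ φ s) {ε : ℝ} (hε : 0 < ε) :
    ∃ m : ℝ → ℝ, ContDiff ℝ ∞ m ∧ (∃ κ > 0, ∀ s, κ ≤ m s) ∧ (∀ s ∈ Icc (0 : ℝ) 1, φ s ≤ m s) ∧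
      ∫ s in (0 : ℝ)..1, m s ≤ (∫ s in (0 : ℝ)..1, φ s) + ε := by
  obtain ⟨p, hp⟩ := exists_polynomial_near_of_continuousOn 0 1 (fun s => φ s + ε / 2)
    (hφ.add continuousOn_const) (ε / 4) (by positivity)
  have hpos : ∀ s, 0 < p.eval s ^ 2 + (ε / 4) ^ 2 := fun s => by positivity
  have hm : ContDiff ℝ ∞ fun s => √(p.eval s ^ 2 + (ε / 4) ^ 2) :=
    (((p.contDiff_aeval (𝕜 := ℝ) ∞).pow 2).add contDiff_const).sqrt fun s => (hpos s).ne'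
  refine ⟨_, hm, ⟨ε / 4, by positivity, fun s => Real.le_sqrt_of_sq_le ?_⟩, fun s hs => ?_, ?_⟩
  · nlinarith [sq_nonneg (p.eval s)]
  · have h1 := abs_lt.1 (hp s hs)
    refine le_trans ?_ (Real.le_sqrt_of_sq_le (x := p.eval s) (by nlinarith [sq_nonneg (ε / 4)]))
    linarith [h1.1]
  · have hle : ∀ s ∈ Icc (0 : ℝ) 1, √(p.eval s ^ 2 + (ε / 4) ^ 2) ≤ φ s + ε := fun s hs => by
      have h1 := abs_lt.1 (hp s hs)
      have h2 := h0 s hs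
      have h3 : 0 ≤ p.eval s := by linarith [h1.1]
      refine (Real.sqrt_le_left (y := p.eval s + ε / 4) (by positivity)).2 ?_ |>.trans
        (by linarith [h1.2])
      nlinarith
    have hint : IntervalIntegrable φ volume 0 1 :=
      ContinuousOn.intervalIntegrable (by rwa [uIcc_of_le zero_le_one])
    refine (intervalIntegral.integral_mono_on zero_le_one (hm.continuous.intervalIntegrable _ _)
      (hint.add intervalIntegrable_const) hle).trans_eq ?_
    rw [intervalIntegral.integral_add hint intervalIntegrable_const]
    simp

/-- A smooth monotone step function on `[0, 1]` which is constant near the endpoints and whose slope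
is almost bounded by `1`. -/
theorem exists_smooth_step {ε : ℝ} (hε : 0 < ε) :
    ∃ (χ χ' : ℝ → ℝ) (δ : ℝ), 0 < δ ∧ ContDiff ℝ ∞ χ' ∧ (∀ t, HasDerivAt χ (χ' t) t) ∧
      (∀ t ≤ δ, χ t = 0) ∧ (∀ t, 1 - δ ≤ t → χ t = 1) ∧ ∀ t, 0 ≤ χ' t ∧ χ' t ≤ 1 + ε := by
  -- with `δ = ε / (4 (1 + ε))` one has `1 - 4 δ = 1 / (1 + ε)`
  set δ := ε / (4 * (1 + ε)) with hδdef
  have hδ : 0 < δ := by positivity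
  have hδ' : 1 - 4 * δ = 1 / (1 + ε) := by rw [hδdef]; field_simp; ring
  have hδ4 : 0 < 1 - 4 * δ := by rw [hδ']; positivity
  set β : ℝ → ℝ := fun t =>
    Real.smoothTransition ((t - δ) / δ) * Real.smoothTransition ((1 - δ - t) / δ) with hβdef
  have hβ : ContDiff ℝ ∞ β := by
    refine ContDiff.mul (Real.smoothTransition.contDiff.comp ?_)
      (Real.smoothTransition.contDiff.comp ?_) <;> fun_prop
  have hβ0 : ∀ t, 0 ≤ β t := fun t =>
    mul_nonneg (Real.smoothTransition.nonneg _) (Real.smoothTransition.nonneg _)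
  have hβ1 : ∀ t, β t ≤ 1 := fun t =>
    mul_le_one₀ (Real.smoothTransition.le_one _) (Real.smoothTransition.nonneg _)
      (Real.smoothTransition.le_one _)
  have hβl : ∀ t ≤ δ, β t = 0 := fun t ht => by
    simp only [hβdef]
    rw [Real.smoothTransition.zero_of_nonpos (div_nonpos_of_nonpos_of_nonneg (by linarith) hδ.le),
      zero_mul]
  have hβr : ∀ t, 1 - δ ≤ t → β t = 0 := fun t ht => by
    simp only [hβdef]
    rw [Real.smoothTransition.zero_of_nonpos (x := (1 - δ - t) / δ)
      (div_nonpos_of_nonpos_of_nonneg (by linarith) hδ.le), mul_zero]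
  have hβm : ∀ t ∈ Icc (2 * δ) (1 - 2 * δ), 1 ≤ β t := fun t ht => by
    simp only [hβdef]
    rw [Real.smoothTransition.one_of_one_le ((one_le_div hδ).2 (by linarith [ht.1])),
      Real.smoothTransition.one_of_one_le ((one_le_div hδ).2 (by linarith [ht.2])), one_mul]
  have hint : ∀ a b, IntervalIntegrable β volume a b := fun a b =>
    hβ.continuous.intervalIntegrable a b
  set Z := ∫ t in (0 : ℝ)..1, β t with hZdef
  have hZ : 1 / (1 + ε) ≤ Z := by
    rw [← hδ', hZdef, ← intervalIntegral.integral_add_adjacent_intervals (hint 0 (2 * δ))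
      (hint _ 1), ← intervalIntegral.integral_add_adjacent_intervals (hint (2 * δ) (1 - 2 * δ))
      (hint _ 1)]
    have h1 : 0 ≤ ∫ t in (0 : ℝ)..2 * δ, β t :=
      intervalIntegral.integral_nonneg (by linarith) fun t _ => hβ0 t
    have h2 : 0 ≤ ∫ t in (1 - 2 * δ)..1, β t :=
      intervalIntegral.integral_nonneg (by linarith) fun t _ => hβ0 t
    have h3 : ∫ _ in (2 * δ)..(1 - 2 * δ), (1 : ℝ) ≤ ∫ t in (2 * δ)..(1 - 2 * δ), β t :=
      intervalIntegral.integral_mono_on (by linarith) intervalIntegrable_const (hint _ _) hβm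
    rw [intervalIntegral.integral_const, smul_eq_mul, mul_one] at h3
    linarith
  have hZpos : 0 < Z := lt_of_lt_of_le (by positivity) hZ
  refine ⟨fun t => (∫ s in (0 : ℝ)..t, β s) / Z, fun t => β t / Z, δ, hδ, hβ.div_const Z,
    fun t => (hasDerivAt_integral_of_contDiff hβ t).div_const Z, fun t ht => ?_, fun t ht => ?_,
    fun t => ⟨div_nonneg (hβ0 t) hZpos.le, ?_⟩⟩
  · have : ∫ s in (0 : ℝ)..t, β s = 0 := by
      refine (intervalIntegral.integral_congr (g := fun _ => 0) fun s hs => ?_).trans (by simp)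
      exact hβl s ((mem_uIcc.1 hs).elim (fun h => h.2.trans ht) fun h => h.2.trans hδ.le)
    simp only [this, zero_div]
  · have : ∫ s in (1 : ℝ)..t, β s = 0 := by
      refine (intervalIntegral.integral_congr (g := fun _ => 0) fun s hs => ?_).trans (by simp)
      exact hβr s ((mem_uIcc.1 hs).elim (fun h => by linarith [h.1]) fun h => by linarith [h.1])
    rw [div_eq_one_iff_eq hZpos.ne', ← intervalIntegral.integral_add_adjacent_intervals
      (hint 0 1) (hint 1 t), this, add_zero]
  · rw [div_le_iff₀ hZpos]
    have : 1 ≤ Z * (1 + ε) := (div_le_iff₀ (by positivity)).1 hZ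
    linarith [hβ1 t]

/-- Reparametrization by arc length, up to `ε`: if a path on `[0, 1]` has speed `φ`, then the path
reparametrized by the smooth function `c` is stationary near the endpoints and its speed is
everywhere at most the length of the original path plus `ε`. The function `c` is the inverse of
a regularized arc length followed by a smooth step. -/
theorem exists_arc_length_reparam {φ : ℝ → ℝ} (hφ : ContinuousOn φ (Icc 0 1))
    (h0 : ∀ s ∈ Icc (0 : ℝ) 1, 0 ≤ φ s) {ε : ℝ} (hε : 0 < ε) :
    ∃ (c c' : ℝ → ℝ) (δ : ℝ), 0 < δ ∧ ContDiff ℝ ∞ c ∧ ContDiff ℝ ∞ c' ∧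
      (∀ t, HasDerivAt c (c' t) t) ∧ (∀ t, c t ∈ Icc (0 : ℝ) 1) ∧ (∀ t ≤ δ, c t = 0) ∧
      (∀ t, 1 - δ ≤ t → c t = 1) ∧
      ∀ t, 0 ≤ c' t ∧ c' t * φ (c t) ≤ (∫ s in (0 : ℝ)..1, φ s) + ε := by
  set ℓ := ∫ s in (0 : ℝ)..1, φ s with hℓ
  have hℓ0 : 0 ≤ ℓ := intervalIntegral.integral_nonneg zero_le_one h0
  obtain ⟨m, hm, ⟨κ, hκ, hκm⟩, hφm, hmint⟩ := exists_contDiff_ge_integral_le hφ h0 (half_pos hε)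
  obtain ⟨χ, χ', δ, hδ, hχ', hχd, hχ0, hχ1, hχb⟩ :=
    exists_smooth_step (ε := ε / 2 / (ℓ + ε / 2)) (by positivity)
  have hmpos : ∀ s, 0 < m s := fun s => hκ.trans_le (hκm s)
  set A := ∫ s in (0 : ℝ)..1, m s with hA
  have hApos : 0 < A := intervalIntegral.intervalIntegral_pos_of_pos
    (hm.continuous.intervalIntegrable _ _) hmpos zero_lt_one
  set b : ℝ → ℝ := fun s => (∫ u in (0 : ℝ)..s, m u) / A with hb
  have hbd : ∀ s, HasDerivAt b (m s / A) s := fun s =>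
    (hasDerivAt_integral_of_contDiff hm s).div_const A
  have hbsmooth : ContDiff ℝ ∞ b := contDiff_of_hasDerivAt hbd (hm.div_const A)
  have hbmono : StrictMono b := strictMono_of_hasDerivAt_pos hbd fun s => div_pos (hmpos s) hApos
  have hb0 : b 0 = 0 := by simp [hb]
  have hb1 : b 1 = 1 := div_self hApos.ne'
  have hmono : Monotone fun s => b s - κ / A * s := by
    refine monotone_of_hasDerivAt_nonneg
      (fun s => (hbd s).sub ((hasDerivAt_id s).const_mul (κ / A))) fun s => ?_
    rw [mul_one, Pi.zero_apply, sub_nonneg]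
    exact div_le_div_of_nonneg_right (hκm s) hApos.le
  have hκA : 0 < κ / A := div_pos hκ hApos
  have hsurj : Function.Surjective b := by
    refine hbsmooth.continuous.surjective ?_ ?_
    · refine tendsto_atTop_mono' _ ?_ (tendsto_id.const_mul_atTop hκA)
      filter_upwards [eventually_ge_atTop 0] with s hs
      have := hmono hs
      simp only [hb0, mul_zero, sub_zero] at this
      exact sub_nonneg.1 this
    · refine tendsto_atBot_mono' _ ?_ (tendsto_id.const_mul_atBot hκA)
      filter_upwards [eventually_le_atBot 0] with s hs
      have := hmono hs
      simp only [hb0, mul_zero, sub_zero] at this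
      exact sub_nonpos.1 this
  set e : ℝ ≃ₜ ℝ := (hbmono.orderIsoOfSurjective b hsurj).toHomeomorph with he
  have hne : ∀ s, m s / A ≠ 0 := fun s => (div_pos (hmpos s) hApos).ne'
  have hesymm : ContDiff ℝ ∞ e.symm := e.contDiff_symm_deriv hne hbd hbsmooth
  have hed : ∀ y, HasDerivAt e.symm (m (e.symm y) / A)⁻¹ y := fun y =>
    HasDerivAt.of_local_left_inverse e.symm.continuous.continuousAt (hbd _) (hne _)
      (Eventually.of_forall fun z => e.apply_symm_apply z)
  have he0 : e.symm 0 = 0 := e.symm_apply_eq.2 hb0.symm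
  have he1 : e.symm 1 = 1 := e.symm_apply_eq.2 hb1.symm
  have hχmono : Monotone χ := monotone_of_hasDerivAt_nonneg hχd fun t => (hχb t).1
  have hχI : ∀ t, χ t ∈ Icc (0 : ℝ) 1 := fun t =>
    ⟨by rw [← hχ0 _ (min_le_right t δ)]; exact hχmono (min_le_left _ _),
      by rw [← hχ1 _ (le_max_right t (1 - δ))]; exact hχmono (le_max_left _ _)⟩
  have hemono : Monotone e.symm := (hbmono.orderIsoOfSurjective b hsurj).symm.monotone
  have hcI : ∀ t, e.symm (χ t) ∈ Icc (0 : ℝ) 1 := fun t =>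
    ⟨by rw [← he0]; exact hemono (hχI t).1, by rw [← he1]; exact hemono (hχI t).2⟩
  have hχsmooth : ContDiff ℝ ∞ χ := contDiff_of_hasDerivAt hχd hχ'
  have hcsmooth : ContDiff ℝ ∞ fun t => e.symm (χ t) := hesymm.comp hχsmooth
  refine ⟨fun t => e.symm (χ t), fun t => (m (e.symm (χ t)) / A)⁻¹ * χ' t, δ, hδ, hcsmooth,
    (((hm.comp hcsmooth).div_const A).inv fun t => hne _).mul hχ',
    fun t => (hed (χ t)).comp t (hχd t), hcI, fun t ht => by simp only [hχ0 t ht, he0],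
    fun t ht => by simp only [hχ1 t ht, he1],
    fun t => ⟨mul_nonneg (inv_nonneg.2 (div_pos (hmpos _) hApos).le) (hχb t).1, ?_⟩⟩
  set s := e.symm (χ t)
  have hs := hφm s (hcI t)
  have h1 : φ s / m s ≤ 1 := (div_le_one (hmpos s)).2 hs
  have h2 : 0 ≤ φ s / m s := div_nonneg (h0 s (hcI t)) (hmpos s).le
  have h3 := hχb t
  calc (m s / A)⁻¹ * χ' t * φ s = A * χ' t * (φ s / m s) := by
        have := (hmpos s).ne'
        field_simp
    _ ≤ A * χ' t * 1 := mul_le_mul_of_nonneg_left h1 (mul_nonneg hApos.le h3.1)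
    _ ≤ (ℓ + ε / 2) * (1 + ε / 2 / (ℓ + ε / 2)) := by
        rw [mul_one]
        exact mul_le_mul hmint h3.2 h3.1 (by positivity)
    _ = ℓ + ε := by field_simp; ring

end Reparametrization

/-! ### Loops and paths with given endpoints -/

section Squares

variable {n : ℕ} {M : Type*} [TopologicalSpace M] [ChartedSpace (Model n) M] [MeasurableSpace M]

/-- A smooth family `k_{s,t}`, `s, t ∈ [0, 1]`, of Hamiltonian diffeomorphisms with supports in a
common compact set: a homotopy of Hamiltonian paths without conditions on the boundary. -/
structure IsHamiltonianSquare (Ω : SymplecticForm n M) (k : ℝ → ℝ → Diff n M) : Prop where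
  smooth : ContMDiffOn ((𝓡 (2 * n)).prod (𝓘(ℝ, ℝ).prod 𝓘(ℝ, ℝ))) (𝓡 (2 * n)) ∞
    (fun p : M × ℝ × ℝ => k p.2.1 p.2.2 p.1) (univ ×ˢ Icc 0 1 ×ˢ Icc 0 1)
  support : ∃ K : Set M, IsCompact K ∧
    ∀ s ∈ Icc (0 : ℝ) 1, ∀ t ∈ Icc (0 : ℝ) 1, closure {x | k s t x ≠ x} ⊆ K
  mem_Ham : ∀ s ∈ Icc (0 : ℝ) 1, ∀ t ∈ Icc (0 : ℝ) 1, k s t ∈ Ham Ω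

variable {Ω : SymplecticForm n M} {k l : ℝ → ℝ → Diff n M} {f g : ℝ → Diff n M}

theorem areHomotopic_iff : AreHomotopic Ω f g ↔ ∃ k, IsHamiltonianSquare Ω k ∧
    (∀ t ∈ Icc (0 : ℝ) 1, k 0 t = f t ∧ k 1 t = g t) ∧
    ∀ s ∈ Icc (0 : ℝ) 1, k s 0 = f 0 ∧ k s 1 = f 1 :=
  ⟨fun ⟨k, h1, h2, h3, h4⟩ => ⟨k, ⟨h1, h2, h3⟩, h4⟩,
    fun ⟨k, ⟨h1, h2, h3⟩, h4⟩ => ⟨k, h1, h2, h3, h4⟩⟩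

namespace IsHamiltonianSquare

theorem of_path (hf : IsHamiltonianPath Ω f) : IsHamiltonianSquare Ω fun _ t => f t := by
  obtain ⟨K, hK, hK'⟩ := hf.1.support
  refine ⟨?_, ⟨K, hK, fun _ _ => hK'⟩, fun _ _ => hf.2⟩
  exact hf.1.smooth.comp (f := fun q : M × ℝ × ℝ => (q.1, q.2.2))
    (contMDiff_fst.prodMk (contMDiff_snd.comp contMDiff_snd)).contMDiffOn
    fun _ hq => ⟨mem_univ _, hq.2.2⟩

theorem reparam (hk : IsHamiltonianSquare Ω k) {a b : ℝ × ℝ → ℝ} (ha : ContDiff ℝ ∞ a)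
    (hb : ContDiff ℝ ∞ b)
    (hmaps : ∀ s ∈ Icc (0 : ℝ) 1, ∀ t ∈ Icc (0 : ℝ) 1,
      a (s, t) ∈ Icc (0 : ℝ) 1 ∧ b (s, t) ∈ Icc (0 : ℝ) 1) :
    IsHamiltonianSquare Ω fun s t => k (a (s, t)) (b (s, t)) := by
  obtain ⟨K, hK, hK'⟩ := hk.support
  refine ⟨?_, ⟨K, hK, fun s hs t ht => hK' _ (hmaps s hs t ht).1 _ (hmaps s hs t ht).2⟩,
    fun s hs t ht => hk.mem_Ham _ (hmaps s hs t ht).1 _ (hmaps s hs t ht).2⟩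
  have hof : ContMDiff ((𝓡 (2 * n)).prod (𝓘(ℝ, ℝ).prod 𝓘(ℝ, ℝ))) 𝓘(ℝ, ℝ × ℝ) ∞
      fun q : M × ℝ × ℝ => q.2 := (contMDiff_ofProd ℝ ℝ).comp contMDiff_snd
  exact hk.smooth.comp (f := fun q : M × ℝ × ℝ => (q.1, a q.2, b q.2))
    (contMDiff_fst.prodMk ((ha.contMDiff.comp hof).prodMk (hb.contMDiff.comp hof))).contMDiffOn
    fun q hq => ⟨mem_univ _, hmaps _ hq.2.1 _ hq.2.2⟩

variable [IsManifold (𝓡 (2 * n)) ∞ M] [T2Space M] [BorelSpace M] [SecondCountableTopology M]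
  [Nonempty M]

theorem trans (hk : IsHamiltonianSquare Ω k) (hl : IsHamiltonianSquare Ω l) :
    IsHamiltonianSquare Ω fun s t => (k s t).trans (l s t) := by
  obtain ⟨K, hK, hK'⟩ := hk.support
  obtain ⟨L, hL, hL'⟩ := hl.support
  refine ⟨?_, ⟨K ∪ L, hK.union hL, fun s hs t ht => (closure_support_trans_subset _ _).trans
    (union_subset_union (hK' s hs t ht) (hL' s hs t ht))⟩,
    fun s hs t ht => trans_mem_Ham (hk.mem_Ham s hs t ht) (hl.mem_Ham s hs t ht)⟩
  exact contMDiffOn_trans_family (N := ℝ × ℝ) (a := fun q => l q.1 q.2) (b := fun q => k q.1 q.2)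
    hl.smooth hk.smooth

theorem symm (hk : IsHamiltonianSquare Ω k) : IsHamiltonianSquare Ω fun s t => (k s t).symm := by
  obtain ⟨K, hK, hK'⟩ := hk.support
  refine ⟨?_, ⟨K, hK, fun s hs t ht => by rw [support_symm]; exact hK' s hs t ht⟩,
    fun s hs t ht => symm_mem_Ham (hk.mem_Ham s hs t ht)⟩
  have h := contMDiffOn_symm_family (φ := fun q : ℝ × ℝ => k q.1 q.2) (S := Icc 0 1 ×ˢ Icc 0 1)
    (uniqueDiffOn_Icc_zero_one.prod uniqueDiffOn_Icc_zero_one)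
    (hk.smooth.comp (f := fun q : M × ℝ × ℝ => q)
      (contMDiff_fst.prodMk ((contMDiff_toProd ℝ ℝ).comp contMDiff_snd)).contMDiffOn
      fun _ hq => hq) hK fun p hp => hK' _ hp.1 _ hp.2
  exact h.comp (f := fun q : M × ℝ × ℝ => q)
    (contMDiff_fst.prodMk ((contMDiff_ofProd ℝ ℝ).comp contMDiff_snd)).contMDiffOn fun _ hq => hq

end IsHamiltonianSquare

end Squares

section PathsAndLoops

variable {n : ℕ} {M : Type*} [TopologicalSpace M] [ChartedSpace (Model n) M] [MeasurableSpace M]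
  {Ω : SymplecticForm n M} {F G H : ℝ → M → ℝ} {f g h : ℝ → Diff n M}

theorem IsNormalizedFlow.isHamiltonianPath (hf : IsNormalizedFlow Ω (Icc 0 1) F f) :
    IsHamiltonianPath Ω f :=
  ⟨hf.flow.path, fun _ ht => hf.mem_Ham ht⟩

/-- Being a normalized Hamiltonian flow over `ℝ` is local in time, apart from the conditions on the
supports and the initial condition. -/
theorem IsNormalizedFlow.of_locally
    (hloc : ∀ t, ∃ F' f', IsNormalizedHamiltonian Ω univ F' ∧ IsDiffPath univ f' ∧
      Generates Ω univ F' f' ∧ ∀ᶠ s in 𝓝 t, F s = F' s ∧ f s = f' s)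
    (hF : NoncompactSpace M → ∃ K : Set M, IsCompact K ∧ ∀ t, tsupport (F t) ⊆ K)
    (hf : ∃ K : Set M, IsCompact K ∧ ∀ t, closure {x | f t x ≠ x} ⊆ K)
    (h0 : f 0 = Diffeomorph.refl (𝓡 (2 * n)) M ∞) : IsNormalizedFlow Ω univ F f := by
  refine ⟨⟨?_, fun t _ => ?_, fun hM => ?_⟩, ⟨?_, ?_⟩, h0, fun t ht x => ?_⟩
  · rintro ⟨x, t⟩ -
    obtain ⟨F', f', hF', -, -, h⟩ := hloc t
    refine ((hF'.smooth.contMDiffAt (by simp)).congr_of_eventuallyEq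
      (f₁ := fun p : M × ℝ => F p.2 p.1) ?_).contMDiffWithinAt
    filter_upwards [(continuous_snd.tendsto (x, t)).eventually h] with p hp
    rw [hp.1]
  · obtain ⟨F', f', hF', -, -, h⟩ := hloc t
    rw [h.self_of_nhds.1]
    exact hF'.normalized t (mem_univ t)
  · obtain ⟨K, hK, hK'⟩ := hF hM
    exact ⟨K, hK, fun t _ => hK' t⟩
  · rintro ⟨x, t⟩ -
    obtain ⟨F', f', -, hf', -, h⟩ := hloc t
    refine ((hf'.smooth.contMDiffAt (by simp)).congr_of_eventuallyEq
      (f₁ := fun p : M × ℝ => f p.2 p.1) ?_).contMDiffWithinAt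
    filter_upwards [(continuous_snd.tendsto (x, t)).eventually h] with p hp
    rw [hp.2]
  · obtain ⟨K, hK, hK'⟩ := hf
    exact ⟨K, hK, fun t _ => hK' t⟩
  · obtain ⟨F', f', -, -, hgen, h⟩ := hloc t
    have h1 := h.self_of_nhds
    have h2 := hgen t ht x
    rw [← h1.1, ← h1.2] at h2
    obtain ⟨ξ, hξ, hξd⟩ := h2
    refine ⟨ξ, hξ, hξd.congr_of_eventuallyEq ?_ (by rw [h1.2])⟩
    rw [nhdsWithin_univ]
    filter_upwards [h] with s hs
    rw [hs.2]

theorem areHomotopic_self (hf : IsHamiltonianPath Ω f) : AreHomotopic Ω f f :=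
  areHomotopic_iff.2 ⟨_, IsHamiltonianSquare.of_path hf, fun _ _ => ⟨rfl, rfl⟩,
    fun _ _ => ⟨rfl, rfl⟩⟩

theorem HasLength.nonneg [Nonempty M] {ℓ : ℝ} (hℓ : HasLength Ω f ℓ) : 0 ≤ ℓ := by
  obtain ⟨F, hF, -, rfl⟩ := hℓ
  exact integral_osc_nonneg hF

variable [IsManifold (𝓡 (2 * n)) ∞ M] [T2Space M] [BorelSpace M] [Nonempty M]

theorem integral_osc_le_uniformNorm (hF : F ∈ periodicHamiltonians Ω)
    (hH : H ∈ periodicHamiltonians Ω) (h : ℝ → Diff n M) :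
    ∫ t in (0 : ℝ)..1, osc (fun x => (F - H) t (h t x)) ≤ uniformNorm (F - H) := by
  have hFH : IsNormalizedHamiltonian Ω univ (F - H) := by
    convert hF.1.add hH.1.neg using 3 with t x
    exact sub_eq_add_neg _ _
  have hbdd := bddAbove_range_osc hFH fun t x => by
    show F (t + 1) x - H (t + 1) x = F t x - H t x
    rw [hF.2, hH.2]
  have hle : ∀ t ∈ uIoc (0 : ℝ) 1, ‖osc (fun x => (F - H) t (h t x))‖ ≤ uniformNorm (F - H) := by
    intro t _
    rw [osc_comp ((F - H) t) (φ := h t) (h t).surjective,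
      Real.norm_of_nonneg (hFH.osc_nonneg (mem_univ t))]
    exact le_ciSup hbdd t
  simpa using (le_abs_self _).trans (intervalIntegral.norm_integral_le_of_norm_le_const hle)

variable [SecondCountableTopology M]

/-- The Hamiltonian of `f` relative to the loop `h`: the path `h_t⁻¹ ∘ f_t` is generated by
`(F_t - H_t) ∘ h_t`. -/
theorem IsNormalizedFlow.symm_trans (hF : IsNormalizedFlow Ω univ F f)
    (hH : IsNormalizedFlow Ω univ H h) :
    IsNormalizedFlow Ω (Icc 0 1) (fun t x => (F - H) t (h t x))
      fun t => (f t).trans (h t).symm := by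
  have := ((hH.symm isTimeInterval_univ).trans isTimeInterval_univ hF).mono (subset_univ (Icc 0 1))
  convert this using 3 with t x
  show F t (h t x) - H t (h t x) = -H t (h t x) + F t (h t x)
  ring

/-- A path `g` on `[0, 1]`, reparametrized by `c`, extended to `ℝ` so that `g_{t+1} = g_t ∘ g_1`:
on `[k, k + 1)` it is `g_{c(t - k)} ∘ f_k`, where `f` is the flow of a 1-periodic Hamiltonian with
the same time-one map as `g`. -/
def periodicExtension (c : ℝ → ℝ) (f g : ℝ → Diff n M) (t : ℝ) : Diff n M :=
  (f ⌊t⌋).trans (g (c (Int.fract t)))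

theorem isNormalizedFlow_periodicExtension (hf : IsNormalizedFlow Ω univ F f)
    (hper : ∀ t x, F (t + 1) x = F t x) (hg : IsNormalizedFlow Ω (Icc 0 1) G g) (hgf : g 1 = f 1)
    {c c' : ℝ → ℝ} {δ : ℝ} (hδ : 0 < δ) (hc : ContDiff ℝ ∞ c) (hc' : ContDiff ℝ ∞ c')
    (hcd : ∀ t, HasDerivAt c (c' t) t) (hcI : ∀ t, c t ∈ Icc (0 : ℝ) 1)
    (hc0 : ∀ t ≤ δ, c t = 0) (hc1 : ∀ t, 1 - δ ≤ t → c t = 1) :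
    IsNormalizedFlow Ω univ (fun t x => c' (Int.fract t) * G (c (Int.fract t)) x)
      (periodicExtension c f g) := by
  have hδ2 : δ < 1 / 2 := by
    by_contra hlt
    have := (hc0 δ le_rfl).symm.trans (hc1 δ (by linarith))
    exact zero_ne_one this
  have hc0' : ∀ t < δ, c' t = 0 := fun t ht => (hcd t).unique <|
    (hasDerivAt_const t (0 : ℝ)).congr_of_eventuallyEq <| by
      filter_upwards [eventually_lt_nhds ht] with s hs using hc0 s hs.le
  have hc1' : ∀ t, 1 - δ < t → c' t = 0 := fun t ht => (hcd t).unique <|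
    (hasDerivAt_const t (1 : ℝ)).congr_of_eventuallyEq <| by
      filter_upwards [eventually_gt_nhds ht] with s hs using hc1 s hs.le
  have hperk : ∀ (k : ℤ) t x, F (t + k) x = F t x := fun k t x => by
    have hp : Function.Periodic (fun t => F t x) 1 := fun t => hper t x
    simpa using hp.int_mul k t
  -- on integer times `f` is a homomorphism
  have hstep : ∀ k : ℤ, f ((k + 1 : ℤ) : ℝ) = (f k).trans (f 1) := fun k => by
    rw [Int.cast_add, Int.cast_one, add_comm]
    exact hf.add_period (hperk k) 1
  have hg0 : g 0 = Diffeomorph.refl (𝓡 (2 * n)) M ∞ := hg.flow.zero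
  have hrefl : ∀ φ : Diff n M, φ.trans (Diffeomorph.refl (𝓡 (2 * n)) M ∞) = φ := fun φ => by
    ext; rfl
  obtain ⟨K, hK, hK'⟩ := hf.flow.path.support
  obtain ⟨L, hL, hL'⟩ := hg.flow.path.support
  refine IsNormalizedFlow.of_locally (fun t => ?_) (fun hM => ?_) ?_ ?_
  · have hck : ContDiff ℝ ∞ fun s => c (s - ⌊t⌋) := hc.comp (by fun_prop)
    have hck' : ContDiff ℝ ∞ fun s => c' (s - ⌊t⌋) := hc'.comp (by fun_prop)
    have hmaps : MapsTo (fun s => c (s - ⌊t⌋)) univ (Icc 0 1) := fun s _ => hcI _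
    refine ⟨fun s x => c' (s - ⌊t⌋) * G (c (s - ⌊t⌋)) x,
      fun s => (f ⌊t⌋).trans (g (c (s - ⌊t⌋))), hg.ham.reparam hck hck' hmaps,
      (hg.flow.path.reparam hck hmaps).precomp hK (hK' _ (mem_univ _)),
      (hg.flow.generates.reparam (fun s hs => (hg.ham.normalized s hs).1)
        (fun s _ => ?_) hmaps).precomp _, ?_⟩
    · exact (hcd _).comp_sub_const s _
    · have hlt : (⌊t⌋ : ℝ) - δ < t := by linarith [Int.floor_le t]
      have hgt : t < (⌊t⌋ : ℝ) + 1 + δ := by linarith [Int.lt_floor_add_one t]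
      filter_upwards [Ioo_mem_nhds hlt hgt] with s hs
      obtain ⟨hs1, hs2⟩ := hs
      unfold periodicExtension
      generalize ⌊t⌋ = k at *
      rcases lt_or_ge s k with hsk | hsk
      · -- to the left of `k` both sides are stationary at `f_k`
        have hfl : ⌊s⌋ = k - 1 := Int.floor_eq_iff.2 (by push_cast; constructor <;> linarith)
        have hfr : Int.fract s = s - k + 1 := by
          rw [← Int.self_sub_floor, hfl]; push_cast; ring
        have hk := hstep (k - 1)
        rw [sub_add_cancel] at hk
        rw [hfl, hfr, hc1 (s - k + 1) (by linarith), hc0 (s - k) (by linarith),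
          hc1' (s - k + 1) (by linarith), hc0' (s - k) (by linarith), hgf, hg0, hrefl, hk]
        simp
      · rcases lt_or_ge s (k + 1) with hsk' | hsk'
        · have hfl : ⌊s⌋ = k := Int.floor_eq_iff.2 ⟨hsk, hsk'⟩
          rw [← Int.self_sub_floor, hfl]
          exact ⟨rfl, rfl⟩
        · -- to the right of `k + 1` both sides are stationary at `f_{k+1}`
          have hfl : ⌊s⌋ = k + 1 := Int.floor_eq_iff.2 (by push_cast; constructor <;> linarith)
          have hfr : Int.fract s = s - k - 1 := by
            rw [← Int.self_sub_floor, hfl]; push_cast; ring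
          rw [hfl, hfr, hc0 (s - k - 1) (by linarith), hc1 (s - k) (by linarith),
            hc0' (s - k - 1) (by linarith), hc1' (s - k) (by linarith), hgf, hg0, hrefl, hstep k]
          simp
  · obtain ⟨K', hK1, hK2⟩ := hg.ham.support hM
    exact ⟨K', hK1, fun t => (closure_mono (Function.support_mul_subset_right _ _)).trans
      (hK2 _ (hcI _))⟩
  · exact ⟨K ∪ L, hK.union hL, fun t => (closure_support_trans_subset _ _).trans
      (union_subset_union (hK' _ (mem_univ _)) (hL' _ (hcI _)))⟩
  · unfold periodicExtension
    rw [Int.floor_zero, Int.fract_zero, hc0 0 hδ.le, hg0, hrefl, Int.cast_zero, hf.flow.zero]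

/-- Every path `g` from `𝟙` to `f_1` of length `ℓ` gives a loop `h_t = f_t ∘ g_{c(t)}⁻¹` whose
Hamiltonian is at distance at most `ℓ + ε` from `F`. -/
theorem exists_loop_of_path (hf : IsNormalizedFlow Ω univ F f)
    (hper : ∀ t x, F (t + 1) x = F t x) (hg : IsNormalizedFlow Ω (Icc 0 1) G g) (hgf : g 1 = f 1)
    {ε : ℝ} (hε : 0 < ε) :
    ∃ (H : ℝ → M → ℝ) (h : ℝ → Diff n M) (c : ℝ → ℝ), H ∈ periodicHamiltonians Ω ∧
      IsHamiltonianFlow Ω univ H h ∧ h 1 = Diffeomorph.refl (𝓡 (2 * n)) M ∞ ∧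
      uniformNorm (F - H) ≤ (∫ t in (0 : ℝ)..1, osc (G t)) + ε ∧ ContDiff ℝ ∞ c ∧
      (∀ t, c t ∈ Icc (0 : ℝ) 1) ∧ c 0 = 0 ∧ c 1 = 1 ∧
      ∀ t ∈ Icc (0 : ℝ) 1, h t = (g (c t)).symm.trans (f t) := by
  obtain ⟨c, c', δ, hδ, hc, hc', hcd, hcI, hc0, hc1, hbound⟩ := exists_arc_length_reparam
    hg.ham.continuousOn_osc (fun _ hs => hg.ham.osc_nonneg hs) hε
  have hp := isNormalizedFlow_periodicExtension hf hper hg hgf hδ hc hc' hcd hcI hc0 hc1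
  have hh := hf.trans isTimeInterval_univ (hp.symm isTimeInterval_univ)
  have hc00 : c 0 = 0 := hc0 0 hδ.le
  have hc11 : c 1 = 1 := hc1 1 (by linarith)
  have hext : ∀ t ∈ Icc (0 : ℝ) 1, periodicExtension c f g t = g (c t) := by
    intro t ht
    unfold periodicExtension
    rcases ht.2.lt_or_eq with h1 | rfl
    · rw [Int.floor_eq_zero_iff.2 ⟨ht.1, h1⟩, Int.fract_eq_self.2 ⟨ht.1, h1⟩, Int.cast_zero,
        hf.flow.zero]
      ext; rfl
    · rw [Int.floor_one, Int.fract_one, Int.cast_one, hc00, hc11, hg.flow.zero, hgf]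
      ext; rfl
  have hadd : ∀ t x, periodicExtension c f g (t + 1) ((f (t + 1)).symm x) =
      periodicExtension c f g t ((f t).symm x) := by
    intro t x
    unfold periodicExtension
    have hfl : f ((⌊t⌋ : ℝ) + 1) = (f 1).trans (f ⌊t⌋) := hf.add_period hper _
    rw [Int.floor_add_one, Int.fract_add_one, Int.cast_add, Int.cast_one, hfl,
      hf.add_period hper t]
    show g _ (f ⌊t⌋ (f 1 ((f 1).symm ((f t).symm x)))) = g _ (f ⌊t⌋ ((f t).symm x))
    rw [Diffeomorph.apply_symm_apply]
  refine ⟨_, _, c, ⟨hh.ham, fun t x => ?_⟩, hh.flow, ?_, ?_, hc, hcI, hc00, hc11,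
    fun t ht => by simp only [hext t ht]⟩
  · show F (t + 1) x + -(c' (Int.fract (t + 1)) * G (c (Int.fract (t + 1)))
        (periodicExtension c f g (t + 1) ((f (t + 1)).symm x))) = _
    rw [hper, Int.fract_add_one, hadd]
  · simp only [hext 1 (right_mem_Icc.2 zero_le_one), hc11, hgf, Diffeomorph.symm_trans_self]
  · refine ciSup_le fun t => ?_
    set u : M → ℝ := fun x => c' (Int.fract t) * G (c (Int.fract t)) x with hu
    set ψ : M → M := fun x => periodicExtension c f g t ((f t).symm x) with hψ
    have hψs : ψ.Surjective := (periodicExtension c f g t).surjective.comp (f t).symm.surjective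
    have hosc : osc (fun x => u (ψ x)) ≤ (∫ t in (0 : ℝ)..1, osc (G t)) + ε := by
      rw [osc_comp u hψs, hu, osc_const_mul _ (hbound _).1]
      exact (hbound _).2
    refine le_trans (le_of_eq (congrArg osc (funext fun x => ?_))) hosc
    show F t x - (F t x + -u (ψ x)) = u (ψ x)
    ring

/-- The loop of `exists_loop_of_path` is contractible if `g` is homotopic to `f`: a homotopy `k`
from `f` to `g` yields the contraction `f_t ∘ k_{s,(1-s)t+sc(t)}⁻¹`. -/
theorem areHomotopic_refl_of_areHomotopic (hf : IsNormalizedFlow Ω univ F f)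
    (hfg : AreHomotopic Ω f g) {c : ℝ → ℝ} (hc : ContDiff ℝ ∞ c)
    (hcI : ∀ t, c t ∈ Icc (0 : ℝ) 1) (hc0 : c 0 = 0) (hc1 : c 1 = 1)
    (hh : ∀ t ∈ Icc (0 : ℝ) 1, h t = (g (c t)).symm.trans (f t)) :
    AreHomotopic Ω h fun _ => Diffeomorph.refl (𝓡 (2 * n)) M ∞ := by
  obtain ⟨k, hk, hk1, hk2⟩ := areHomotopic_iff.1 hfg
  have hb : ∀ s ∈ Icc (0 : ℝ) 1, ∀ t ∈ Icc (0 : ℝ) 1,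
      s * t + (1 - s) * c t ∈ Icc (0 : ℝ) 1 := fun s hs t ht =>
    (convex_Icc (0 : ℝ) 1) ht (hcI t) hs.1 (sub_nonneg.2 hs.2) (add_sub_cancel s 1)
  have hsq := (hk.reparam (a := fun q => 1 - q.1) (b := fun q => q.1 * q.2 + (1 - q.1) * c q.2)
    (by fun_prop) (by fun_prop) fun s hs t ht => ⟨⟨sub_nonneg.2 hs.2, by linarith [hs.1]⟩,
      hb s hs t ht⟩).symm.trans
    (IsHamiltonianSquare.of_path (hf.mono (subset_univ _)).isHamiltonianPath)
  have h0 : (0 : ℝ) ∈ Icc (0 : ℝ) 1 := by simp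
  have h1 : (1 : ℝ) ∈ Icc (0 : ℝ) 1 := by simp
  have hg0 : g 0 = f 0 := by rw [← (hk1 0 h0).2, (hk2 1 h1).1]
  have hg1 : g 1 = f 1 := by rw [← (hk1 1 h1).2, (hk2 1 h1).2]
  refine areHomotopic_iff.2 ⟨_, hsq, fun t ht => ⟨?_, ?_⟩, fun s hs => ⟨?_, ?_⟩⟩
  · simp only [sub_zero, zero_mul, zero_add, one_mul]
    rw [(hk1 _ (hcI t)).2, hh t ht]
  · simp only [sub_self, zero_mul, add_zero, one_mul]
    rw [(hk1 t ht).1, Diffeomorph.symm_trans_self]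
  · have hs' : 1 - s ∈ Icc (0 : ℝ) 1 := ⟨sub_nonneg.2 hs.2, by linarith [hs.1]⟩
    simp only [hc0, mul_zero, add_zero]
    rw [(hk2 _ hs').1, hh 0 h0, hc0, hg0]
  · have hs' : 1 - s ∈ Icc (0 : ℝ) 1 := ⟨sub_nonneg.2 hs.2, by linarith [hs.1]⟩
    simp only [hc1, mul_one, add_sub_cancel]
    rw [(hk2 _ hs').2, hh 1 h1, hc1, hg1]

/-- If the loop `h` is contractible, then `h_t⁻¹ ∘ f_t` is homotopic to `f_t`. -/
theorem areHomotopic_trans_symm (hf : IsNormalizedFlow Ω univ F f)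
    (hh0 : h 0 = Diffeomorph.refl (𝓡 (2 * n)) M ∞) (hh1 : h 1 = Diffeomorph.refl (𝓡 (2 * n)) M ∞)
    (hh : AreHomotopic Ω h fun _ => Diffeomorph.refl (𝓡 (2 * n)) M ∞) :
    AreHomotopic Ω f fun t => (f t).trans (h t).symm := by
  obtain ⟨k, hk, hk1, hk2⟩ := areHomotopic_iff.1 hh
  have hsq := (IsHamiltonianSquare.of_path (hf.mono (subset_univ _)).isHamiltonianPath).trans
    (hk.reparam (a := fun q => 1 - q.1) (b := fun q => q.2) (by fun_prop) (by fun_prop)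
      fun s hs t ht => ⟨⟨sub_nonneg.2 hs.2, by linarith [hs.1]⟩, ht⟩).symm
  have hrefl : ∀ φ : Diff n M, φ.trans (Diffeomorph.refl (𝓡 (2 * n)) M ∞).symm = φ := fun φ => by
    ext; rfl
  refine areHomotopic_iff.2 ⟨_, hsq, fun t ht => ⟨?_, ?_⟩, fun s hs => ⟨?_, ?_⟩⟩
  · simp only [sub_zero]
    rw [(hk1 t ht).2, hrefl]
  · simp only [sub_self]
    rw [(hk1 t ht).1]
  · have hs' : 1 - s ∈ Icc (0 : ℝ) 1 := ⟨sub_nonneg.2 hs.2, by linarith [hs.1]⟩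
    rw [(hk2 _ hs').1, hh0, hrefl]
  · have hs' : 1 - s ∈ Icc (0 : ℝ) 1 := ⟨sub_nonneg.2 hs.2, by linarith [hs.1]⟩
    rw [(hk2 _ hs').2, hh1, hrefl]

end PathsAndLoops

end Hofer

end

theorem mainTheorem4 (n : ℕ) (M : Type*) [TopologicalSpace M] [T2Space M]
    [SecondCountableTopology M] [ConnectedSpace M]
    [ChartedSpace (Hofer.Model n) M] [IsManifold (𝓡 (2 * n)) ∞ M]
    [MeasurableSpace M] [BorelSpace M]
    (Ω : Hofer.SymplecticForm n M)
    (F : ℝ → M → ℝ) (hF : F ∈ Hofer.periodicHamiltonians Ω)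
    (f : ℝ → Hofer.Diff n M) (hf : Hofer.IsHamiltonianFlow Ω Set.univ F f) :
    IsGLB {r : ℝ | ∃ H ∈ Hofer.loopHamiltonians Ω, r = Hofer.uniformNorm (F - H)}
        (Hofer.hoferDist Ω (Diffeomorph.refl (𝓡 (2 * n)) M ∞) (f 1)) ∧
      IsGLB {r : ℝ | ∃ H ∈ Hofer.contractibleLoopHamiltonians Ω, r = Hofer.uniformNorm (F - H)}
        (Hofer.homotopyLength Ω f) := by
  have hflow : Hofer.IsNormalizedFlow Ω univ F f := ⟨hF.1, hf⟩
  have hflow' := hflow.mono (subset_univ (Icc 0 1))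
  have hlen : Hofer.HasLength Ω f (∫ t in (0 : ℝ)..1, Hofer.osc (F t)) :=
    ⟨F, hflow'.ham, hflow'.flow.generates, rfl⟩
  refine ⟨⟨?_, fun b hb => ?_⟩, ⟨?_, fun b hb => ?_⟩⟩
  · rintro r ⟨H, ⟨hH, h, hh, hh1⟩, rfl⟩
    have hg := hflow.symm_trans ⟨hH.1, hh⟩
    refine le_trans ?_ (Hofer.integral_osc_le_uniformNorm hF hH h)
    refine csInf_le ⟨0, ?_⟩ ⟨_, hg.isHamiltonianPath, hg.flow.zero, ?_, _, hg.ham,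
      hg.flow.generates, rfl⟩
    · rintro ℓ ⟨_, -, -, -, hℓ⟩
      exact hℓ.nonneg
    · rw [hh1]; rfl
  · refine le_csInf ⟨_, f, hflow'.isHamiltonianPath, hf.zero, rfl, hlen⟩ ?_
    rintro ℓ ⟨g, hg, hg0, hg1, G, hG, hgG, rfl⟩
    refine le_of_forall_pos_le_add fun ε hε => ?_
    obtain ⟨H, h, c, hH, hh, hh1, hle, -⟩ :=
      Hofer.exists_loop_of_path hflow hF.2 ⟨hG, hg.1, hg0, hgG⟩ hg1 hε
    exact (mem_lowerBounds.1 hb _ ⟨H, ⟨hH, h, hh, hh1⟩, rfl⟩).trans hle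
  · rintro r ⟨H, ⟨hH, h, hh, hh1, hhc⟩, rfl⟩
    have hg := hflow.symm_trans ⟨hH.1, hh⟩
    refine le_trans ?_ (Hofer.integral_osc_le_uniformNorm hF hH h)
    refine csInf_le ⟨0, ?_⟩ ⟨_, hg.isHamiltonianPath, ?_, ?_,
      Hofer.areHomotopic_trans_symm hflow hh.zero hh1 hhc, _, hg.ham, hg.flow.generates, rfl⟩
    · rintro ℓ ⟨_, -, -, -, -, hℓ⟩
      exact hℓ.nonneg
    · exact hg.flow.zero.trans hf.zero.symm
    · rw [hh1]; rfl
  · refine le_csInf ⟨_, f, hflow'.isHamiltonianPath, rfl, rfl,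
      Hofer.areHomotopic_self hflow'.isHamiltonianPath, hlen⟩ ?_
    rintro ℓ ⟨g, hg, hg0, hg1, hfg, G, hG, hgG, rfl⟩
    refine le_of_forall_pos_le_add fun ε hε => ?_
    obtain ⟨H, h, c, hH, hh, hh1, hle, hc, hcI, hc0, hc1, hhc⟩ :=
      Hofer.exists_loop_of_path hflow hF.2 ⟨hG, hg.1, hg0.trans hf.zero, hgG⟩ hg1 hε
    exact (mem_lowerBounds.1 hb _ ⟨H, ⟨hH, h, hh, hh1,
      Hofer.areHomotopic_refl_of_areHomotopic hflow hfg hc hcI hc0 hc1 hhc⟩, rfl⟩).trans hle
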